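/- Let $J\subseteq\mathbb R$ be an open interval, $F$ a smooth manifold, $\beta$ a positive smooth function on $J$ and $(g_t)_{t\in J}$ a smooth one-parameter family of Riemannian metrics on $F$. The Riemannian manifold $(J\times F,\ \beta\,dt^2+g_t)$ is called \emph{expanding throughout $\partial_t$} if $\partial_t\beta\ge 0$ on $J$ and $(\partial_t g_t)(u,u)>0$ for every $t\in J$ and every nonzero tangent vector $u$ of $F$. Let $(M,g)$ be a smooth (Hausdorff) Riemannian manifold without boundary of dimension $m\ge 1$, let $p\in M$, let $\exp_p$ be its exponential map at $p$, and let $\mathbb S_p=\{v\in T_pM:\ g_p(v,v)=1\}$. For $\epsilon>0$ write $B(p,\epsilon)=\exp_p(\{v\in T_pM:\ |v|<\epsilon\})$. Then there is $\delta_p>0$ such that for every $0<\epsilon\le\delta_p$: (1) $B(p,\epsilon)$ is a geodesic ball: $\exp_p$ is defined on $\{v\in T_pM:|v|<\epsilon\}$ and maps it diffeomorphically onto the open subset $B(p,\epsilon)$ of $M$; (2) $(B(p,\epsilon)\setminus\{p\},g)$ is expanding throughout the radial polar geodesic vector field $\partial_r$ centered at $p$, where $\partial_r|_{\exp_p(rv)}=\frac{d}{dr}\exp_p(rv)$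 for $0<r<\epsilon$, $v\in\mathbb S_p$. That is, there is a smooth family $(h_r)_{0<r<\epsilon}$ of Riemannian metrics on $\mathbb S_p$ such that the polar map $(r,v)\mapsto\exp_p(rv)$ is an isometry of $\big((0,\epsilon)\times\mathbb S_p,\ dr^2+h_r\big)$ onto $(B(p,\epsilon)\setminus\{p\},g)$ carrying the coordinate field of the factor $(0,\epsilon)$ to $\partial_r$, and $\big((0,\epsilon)\times\mathbb S_p,\ dr^2+h_r\big)$ is expanding throughout that coordinate field. -/

import Mathlib

open Set Manifold Bundle
open scoped ContDiff

noncomputable section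

namespace RadialExpansion

/-! ### Geodesics and the exponential map of a Riemannian manifold -/

section Geodesics

variable {m : ℕ} {M : Type*} [TopologicalSpace M] [ChartedSpace (EuclideanSpace ℝ (Fin m)) M]
  [IsManifold (𝓡 m) ∞ M] [RiemannianBundle (fun x : M ↦ TangentSpace (𝓡 m) x)]

/-- The metric in the coordinates of the chart at `x₀`: the value `g_y(a, b)` of the metric tensor,
transported to the target of the chart, at the point `y` and on the vectors `a`, `b` of `ℝᵐ`. -/
def chartMetric (x₀ : M) (y a b : EuclideanSpace ℝ (Fin m)) : ℝ :=
  inner ℝ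
    (mfderiv 𝓘(ℝ, EuclideanSpace ℝ (Fin m)) (𝓡 m) (extChartAt (𝓡 m) x₀).symm y a)
    (mfderiv 𝓘(ℝ, EuclideanSpace ℝ (Fin m)) (𝓡 m) (extChartAt (𝓡 m) x₀).symm y b)

/-- The Christoffel symbols of the first kind, in the chart at `x₀` and at the coordinate point `y`:
`Γ(a, b; w) = (∂_a g(b, w) + ∂_b g(a, w) - ∂_w g(a, b)) / 2`. -/
def christoffelFirst (x₀ : M) (y a b w : EuclideanSpace ℝ (Fin m)) : ℝ :=
  (fderiv ℝ (fun z ↦ chartMetric x₀ z b w) y a + fderiv ℝ (fun z ↦ chartMetric x₀ z a w) y b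
    - fderiv ℝ (fun z ↦ chartMetric x₀ z a b) y w) / 2

/-- `γ` is a geodesic on the open set `J` of parameters: it is smooth there, and in every chart its
coordinate expression `c` satisfies the geodesic equation `g(c'', w) + Γ(c', c'; w) = 0` for all
`w`, that is, `c''ᵏ + Γᵏᵢⱼ c'ⁱ c'ʲ = 0`. -/
def IsGeodesicOn (γ : ℝ → M) (J : Set ℝ) : Prop :=
  ContMDiffOn 𝓘(ℝ, ℝ) (𝓡 m) ∞ γ J ∧
  ∀ t ∈ J, ∀ x₀ : M, γ t ∈ (extChartAt (𝓡 m) x₀).source →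
    ∀ w : EuclideanSpace ℝ (Fin m),
      let c : ℝ → EuclideanSpace ℝ (Fin m) := fun s ↦ extChartAt (𝓡 m) x₀ (γ s)
      chartMetric x₀ (c t) (deriv (deriv c) t) w
        + christoffelFirst x₀ (c t) (deriv c t) (deriv c t) w = 0

/-- `γ` is a geodesic, defined on an open interval that contains `[0, 1]`, with `γ 0 = p` and
`γ' 0 = v`. -/
def IsGeodesicFrom (p : M) (v : TangentSpace (𝓡 m) p) (γ : ℝ → M) : Prop :=
  (∃ a b : ℝ, a < 0 ∧ 1 < b ∧ IsGeodesicOn (m := m) γ (Ioo a b)) ∧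
  (⟨γ 0, mfderiv 𝓘(ℝ, ℝ) (𝓡 m) γ 0 (1 : ℝ)⟩ : TangentBundle (𝓡 m) M) = ⟨p, v⟩

/-- The domain of the exponential map at `p`. -/
def expDomain (p : M) : Set (TangentSpace (𝓡 m) p) := {v | ∃ γ : ℝ → M, IsGeodesicFrom (m := m) p v γ}

open Classical in
/-- The exponential map at `p`: `exp_p v = γ 1` for the geodesic `γ` with `γ 0 = p`, `γ' 0 = v`
(and the value `p` outside the domain of the exponential map). -/
def expMap (p : M) (v : TangentSpace (𝓡 m) p) : M :=
  if h : ∃ γ : ℝ → M, IsGeodesicFrom (m := m) p v γ then h.choose 1 else p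

/-- The image of the open ball of radius `ε` of `T_p M` under the exponential map. -/
def geodesicBall (p : M) (ε : ℝ) : Set M :=
  expMap p '' Metric.ball (0 : TangentSpace (𝓡 m) p) ε

/-- The set `geodesicBall p ε` is a genuine (normal) geodesic ball: the exponential map is defined
on the open ball of radius `ε` of `T_p M` and is a diffeomorphism of it onto an open subset
of `M`. -/
def IsNormalBall (p : M) (ε : ℝ) : Prop :=
  Metric.ball (0 : TangentSpace (𝓡 m) p) ε ⊆ expDomain p ∧
  ∃ e : PartialDiffeomorph 𝓘(ℝ, TangentSpace (𝓡 m) p) (𝓡 m) (TangentSpace (𝓡 m) p) M ∞,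
    e.source = Metric.ball (0 : TangentSpace (𝓡 m) p) ε ∧ e.target = geodesicBall (m := m) p ε ∧
    EqOn e (expMap p) e.source

/-- Polar coordinates centered at `p`: `(r, v) ↦ exp_p (r v)`, where `v` runs over the unit sphere
of `T_p M`. -/
def polarMap (p : M) (q : ℝ × Metric.sphere (0 : TangentSpace (𝓡 m) p) 1) : M :=
  expMap p (q.1 • (q.2 : TangentSpace (𝓡 m) p))

/-- `Z` is the radial polar geodesic vector field centered at `p` on the punctured geodesic ball of
radius `ε`: its value at `exp_p (r v)` is the velocity at `r` of the geodesic `s ↦ exp_p (s v)`,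
for unit vectors `v` and `0 < r < ε`. -/
def IsRadialField (p : M) (ε : ℝ) (Z : ∀ q : M, TangentSpace (𝓡 m) q) : Prop :=
  ∀ r ∈ Ioo 0 ε, ∀ v : TangentSpace (𝓡 m) p, ‖v‖ = 1 →
    Z (expMap p (r • v)) = mfderiv 𝓘(ℝ, ℝ) (𝓡 m) (fun s : ℝ ↦ expMap p (s • v)) r (1 : ℝ)

end Geodesics

/-! ### Riemannian manifolds of the form `(J × F, β dt² + g_t)` -/

section Products

variable {k : ℕ}

/-- The data of a Riemannian metric `β dt² + g_t` on `J × F`: an open interval `J`, a positive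
smooth function `β` on `J`, and a family `g_t`, `t ∈ J`, of Riemannian metrics on `F` that is
smooth in `(t, x)`. -/
structure ProductMetric (J : Set ℝ) (F : Type*) [TopologicalSpace F]
    [ChartedSpace (EuclideanSpace ℝ (Fin k)) F] [IsManifold (𝓡 k) ∞ F] where
  isOpen : IsOpen J
  ordConnected : J.OrdConnected
  β : ℝ → ℝ
  β_pos : ∀ t ∈ J, 0 < β t
  β_smooth : ContDiffOn ℝ ∞ β J
  g : ℝ → ∀ x : F, TangentSpace (𝓡 k) x →L[ℝ] TangentSpace (𝓡 k) x →L[ℝ] ℝ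
  g_symm : ∀ t ∈ J, ∀ (x : F) (u w : TangentSpace (𝓡 k) x), g t x u w = g t x w u
  g_pos : ∀ t ∈ J, ∀ (x : F) (u : TangentSpace (𝓡 k) x), u ≠ 0 → 0 < g t x u u
  g_smooth : ContMDiffOn (𝓘(ℝ, ℝ).prod (𝓡 k))
    ((𝓡 k).prod 𝓘(ℝ, EuclideanSpace ℝ (Fin k) →L[ℝ] EuclideanSpace ℝ (Fin k) →L[ℝ] ℝ)) ∞
    (fun q : ℝ × F ↦ TotalSpace.mk' (EuclideanSpace ℝ (Fin k) →L[ℝ] EuclideanSpace ℝ (Fin k) →L[ℝ] ℝ)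
      (E := fun x : F ↦ TangentSpace (𝓡 k) x →L[ℝ] TangentSpace (𝓡 k) x →L[ℝ] ℝ)
      q.2 (g q.1 q.2)) (J ×ˢ univ)

variable {J : Set ℝ} {F : Type*} [TopologicalSpace F]
  [ChartedSpace (EuclideanSpace ℝ (Fin k)) F] [IsManifold (𝓡 k) ∞ F]

/-- `(J × F, β dt² + g_t)` is expanding throughout `∂_t`: `∂_t β ≥ 0`, and `(∂_t g_t)(u, u) > 0` for
every nonzero tangent vector `u` of `F`. -/
def ProductMetric.IsExpanding (G : ProductMetric (k := k) J F) : Prop :=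
  ∀ t ∈ J, 0 ≤ deriv G.β t ∧
    ∀ (x : F) (u : TangentSpace (𝓡 k) x), u ≠ 0 → 0 < deriv (fun s ↦ G.g s x u u) t

variable {m : ℕ} {M : Type*} [TopologicalSpace M] [ChartedSpace (EuclideanSpace ℝ (Fin m)) M]
  [IsManifold (𝓡 m) ∞ M] [RiemannianBundle (fun x : M ↦ TangentSpace (𝓡 m) x)]

/-- `Φ` is an isometry of `(J × F, β dt² + g_t)` onto the open subset `U` of the Riemannian manifold
`M` that carries `∂_t` to the vector field `Z`. -/
structure ProductMetric.IsIsometryOnto (G : ProductMetric (k := k) J F) (Φ : ℝ × F → M) (U : Set M)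
    (Z : ∀ q : M, TangentSpace (𝓡 m) q) : Prop where
  diffeo : ∃ e : PartialDiffeomorph (𝓘(ℝ, ℝ).prod (𝓡 k)) (𝓡 m) (ℝ × F) M ∞,
    e.source = J ×ˢ univ ∧ e.target = U ∧ EqOn e Φ e.source
  metric_eq : ∀ t ∈ J, ∀ (x : F) (a b : ℝ) (u w : TangentSpace (𝓡 k) x),
    inner ℝ (mfderiv (𝓘(ℝ, ℝ).prod (𝓡 k)) (𝓡 m) Φ (t, x) (a, u))
      (mfderiv (𝓘(ℝ, ℝ).prod (𝓡 k)) (𝓡 m) Φ (t, x) (b, w)) = G.β t * (a * b) + G.g t x u w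
  map_dt : ∀ t ∈ J, ∀ x : F,
    mfderiv (𝓘(ℝ, ℝ).prod (𝓡 k)) (𝓡 m) Φ (t, x) ((1 : ℝ), (0 : TangentSpace (𝓡 k) x))
      = Z (Φ (t, x))

end Products

/-- The tangent spaces of an `(n+1)`-dimensional manifold have dimension `n+1`; this gives their
unit spheres the structure of an `n`-dimensional manifold. -/
instance finrankTangent {n : ℕ} {M : Type*} [TopologicalSpace M]
    [ChartedSpace (EuclideanSpace ℝ (Fin (n + 1))) M] (p : M) :
    Fact (Module.finrank ℝ (TangentSpace (𝓡 (n + 1)) p) = n + 1) :=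
  ⟨finrank_euclideanSpace_fin (𝕜 := ℝ) (n := n + 1)⟩

end RadialExpansion

end

/-! In normal coordinates `v ↦ exp_p v` the metric becomes a smooth family `H_x` of inner products
on `T_pM`, with `H_0` the given one. The Gauss lemma `H_x(x, u) = ⟨x, u⟩` makes the radial direction
a unit vector orthogonal to the spheres, so polar coordinates give `dr² + h_r` with `h_r(u, u) = r²
H_{rv}(u, u)` at `v`. The derivative `2r H_{rv}(u, u) + r² (∂_v H)_{rv}(u, u)` is at least `r|u|²(1
- Cr)` near `0`, where `C` bounds `DH` and `H_x(u, u) ≥ |u|²/2`. It is therefore positive for small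
`r`, uniformly in `v` (`exists_radius_expanding`, `exists_polar_isometry`).

The smooth exponential map is built in one chart. The geodesic equation reads `c'' = S(c, c')` with
`S` quadratic in the velocity. The acceleration is taken as an unknown in `C([0,1], E)`; at zero
data the linearised equation does not see `S`, so the implicit function theorem yields paths
depending smoothly on the initial velocity (`exists_path_family`). Quadratic scaling identifies them
with the rays of a single map `𝓔` (`exists_radial_solution`). The Gauss lemma follows by
differentiating the constancy of speed in the initial velocity (`energy`, `fderiv_energy`, `gauss`).

The chart construction agrees with `expMap` because the geodesic equation is invariant under
coordinate changes (`geodesicForm_pullback`) and a geodesic is determined by its initial velocity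
(`IsGeodesicFrom.apply_one_eq`). -/

section

set_option maxSynthPendingDepth 3

open Filter Topology Metric RadialExpansion

/-! ### Smoothness of composition operators on spaces of continuous functions -/

namespace ContinuousMap

universe u

variable {X : Type*} [TopologicalSpace X] [CompactSpace X] {E F : Type u}
  [NormedAddCommGroup E] [NormedSpace ℝ E] [NormedAddCommGroup F] [NormedSpace ℝ F]

/-- Pointwise application of a continuous bilinear map to continuous functions. -/
noncomputable def bilinCLM {A : Type u} [NormedAddCommGroup A] [NormedSpace ℝ A]
    (B : A →L[ℝ] E →L[ℝ] F) : C(X, A) →L[ℝ] C(X, E) →L[ℝ] C(X, F) :=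
  LinearMap.mkContinuous₂
    (LinearMap.mk₂ ℝ (fun (a : C(X, A)) (c : C(X, E)) ↦
      (⟨fun x ↦ B (a x) (c x), by fun_prop⟩ : C(X, F)))
      (fun _ _ _ ↦ by ext; simp) (fun _ _ _ ↦ by ext; simp)
      (fun _ _ _ ↦ by ext; simp) (fun _ _ _ ↦ by ext; simp)) ‖B‖ fun a c ↦ by
    rw [ContinuousMap.norm_le _ (by positivity)]
    exact fun x ↦ (B.le_opNorm₂ (a x) (c x)).trans
      (by gcongr; exacts [a.norm_coe_le_norm x, c.norm_coe_le_norm x])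

@[simp]
theorem bilinCLM_apply {A : Type u} [NormedAddCommGroup A] [NormedSpace ℝ A]
    (B : A →L[ℝ] E →L[ℝ] F) (a : C(X, A)) (c : C(X, E)) (x : X) :
    bilinCLM B a c x = B (a x) (c x) := rfl

theorem contDiff_bilinCLM {A : Type u} [NormedAddCommGroup A] [NormedSpace ℝ A]
    (B : A →L[ℝ] E →L[ℝ] F) {W : Type*} [NormedAddCommGroup W] [NormedSpace ℝ W] {n : ℕ∞ω}
    {g : W → C(X, A)} (hg : ContDiff ℝ n g) : ContDiff ℝ n fun w ↦ bilinCLM (E := E) B (g w) :=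
  (bilinCLM (X := X) B).contDiff.comp hg

/-- Pointwise application of a continuous family of operators, as a continuous linear map into the
operators between spaces of continuous functions. -/
noncomputable def applyCLM : C(X, E →L[ℝ] F) →L[ℝ] C(X, E) →L[ℝ] C(X, F) :=
  bilinCLM (ContinuousLinearMap.id ℝ (E →L[ℝ] F))

@[simp]
theorem applyCLM_apply (A : C(X, E →L[ℝ] F)) (c : C(X, E)) (x : X) :
    applyCLM A c x = A x (c x) := rfl

/-- The range of `c` is compact, so `fderiv ℝ f` is uniformly continuous near it. The mean value
inequality then bounds the remainder by `ε ‖h‖` with one `δ` for all points of `X`. -/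
theorem hasFDerivAt_comp_left {f : E → F} (hf : ContDiff ℝ 1 f) (c : C(X, E)) :
    HasFDerivAt (fun c : C(X, E) ↦ (⟨f, hf.continuous⟩ : C(E, F)).comp c)
      (applyCLM ((⟨fderiv ℝ f, hf.continuous_fderiv one_ne_zero⟩ : C(E, E →L[ℝ] F)).comp c)) c := by
  rw [hasFDerivAt_iff_isLittleO_nhds_zero, Asymptotics.isLittleO_iff]
  intro ε hε
  have hK : IsCompact (range c) := isCompact_range c.continuous
  have huc := hK.uniformContinuousAt_of_continuousAt (fderiv ℝ f)
    (fun a _ ↦ (hf.continuous_fderiv one_ne_zero).continuousAt) (Metric.dist_mem_uniformity hε)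
  obtain ⟨δ, hδ, hδ'⟩ := Metric.mem_uniformity_dist.1 huc
  filter_upwards [Metric.ball_mem_nhds (0 : C(X, E)) hδ] with h hh
  rw [mem_ball_zero_iff] at hh
  rw [ContinuousMap.norm_le _ (by positivity)]
  intro x
  have hx : ‖h x‖ < δ := (h.norm_coe_le_norm x).trans_lt hh
  have key := (convex_ball (c x) δ).norm_image_sub_le_of_norm_hasFDerivWithin_le'
    (f := f) (f' := fderiv ℝ f) (φ := fderiv ℝ f (c x)) (C := ε) (x := c x) (y := c x + h x)
    (fun z _ ↦ ((hf.differentiable one_ne_zero) z).hasFDerivAt.hasFDerivWithinAt)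
    (fun z hz ↦ by
      have := hδ' (a := c x) (b := z) (by rwa [dist_comm]) (mem_range_self x)
      rw [← dist_eq_norm, dist_comm]
      exact le_of_lt this)
    (mem_ball_self hδ) (by simpa using hx)
  rw [add_sub_cancel_left] at key
  refine le_trans ?_ (mul_le_mul_of_nonneg_left (h.norm_coe_le_norm x) hε.le)
  simpa using key

theorem hasFDerivAt_comp_left_of_fderiv_eq_zero {f : E → F} (hf : ContDiff ℝ 1 f) (c : C(X, E))
    (h : ∀ x, fderiv ℝ f (c x) = 0) :
    HasFDerivAt (fun c : C(X, E) ↦ (⟨f, hf.continuous⟩ : C(E, F)).comp c)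
      (0 : C(X, E) →L[ℝ] C(X, F)) c := by
  refine (hasFDerivAt_comp_left hf c).congr_fderiv ?_
  refine ContinuousLinearMap.ext fun c' ↦ ContinuousMap.ext fun x ↦ ?_
  simp [h]

/-- The derivative is again a composition operator, with `fderiv ℝ f` in place of `f`, followed by a
continuous linear map. The induction must range over `F`, since it passes from `F` to `E →L[ℝ] F`;
hence the common universe. -/
theorem contDiff_comp_left_nat (n : ℕ) : ∀ {F : Type u} [NormedAddCommGroup F] [NormedSpace ℝ F]
    {f : E → F} (hf : ContDiff ℝ n f),
    ContDiff ℝ n (fun c : C(X, E) ↦ (⟨f, hf.continuous⟩ : C(E, F)).comp c) := by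
  induction n with
  | zero =>
    intro F _ _ f hf
    exact contDiff_zero.2 (ContinuousMap.continuous_postcomp _)
  | succ n ih =>
    intro F _ _ f hf
    have hf' : ContDiff ℝ (n + 1) f := by exact_mod_cast hf
    have hf1 : ContDiff ℝ 1 f := hf'.of_le le_add_self
    have hd : ContDiff ℝ n (fderiv ℝ f) := hf'.fderiv_right le_rfl
    push_cast
    refine contDiff_succ_iff_hasFDerivAt.2
      ⟨fun c ↦ applyCLM ((⟨fderiv ℝ f, hd.continuous⟩ : C(E, E →L[ℝ] F)).comp c), ?_,
        fun c ↦ hasFDerivAt_comp_left hf1 c⟩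
    exact contDiff_bilinCLM (ContinuousLinearMap.id ℝ (E →L[ℝ] F)) (ih hd)

/-- Composition with a smooth map is a smooth map between spaces of continuous functions. -/
theorem contDiff_comp_left {f : E → F} (hf : ContDiff ℝ ∞ f) :
    ContDiff ℝ ∞ (fun c : C(X, E) ↦ (⟨f, hf.continuous⟩ : C(E, F)).comp c) :=
  contDiff_infty.2 fun n ↦ contDiff_comp_left_nat n (contDiff_infty.1 hf n)

end ContinuousMap

/-! ### Implicit functions that are smooth on a neighbourhood -/

section ImplicitFunction

variable {E₁ E₂ F : Type*} [NormedAddCommGroup E₁] [NormedSpace ℝ E₁] [CompleteSpace E₁]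
  [NormedAddCommGroup E₂] [NormedSpace ℝ E₂] [CompleteSpace E₂]
  [NormedAddCommGroup F] [NormedSpace ℝ F] [CompleteSpace F]

/-- The smooth implicit function theorem, with smoothness on a neighbourhood. -/
theorem ContDiff.exists_implicitFunction {Φ : E₁ × E₂ → F} (hΦ : ContDiff ℝ ∞ Φ) (u : E₁ × E₂)
    (hinv : (fderiv ℝ Φ u ∘L .inr ℝ E₁ E₂).IsInvertible) :
    ∃ ψ : E₁ → E₂, ψ u.1 = u.2 ∧ (∀ᶠ x in 𝓝 u.1, ContDiffAt ℝ ∞ ψ x) ∧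
      (∀ᶠ x in 𝓝 u.1, Φ (x, ψ x) = Φ u) ∧ (∀ᶠ v in 𝓝 u, Φ v = Φ u ↔ ψ v.1 = v.2) ∧
      HasFDerivAt ψ
        (-(fderiv ℝ Φ u ∘L .inr ℝ E₁ E₂).inverse ∘L (fderiv ℝ Φ u ∘L .inl ℝ E₁ E₂)) u.1 := by
  have hn : (∞ : ℕ∞ω) ≠ 0 := by simp
  have cd := hΦ.contDiffAt (x := u)
  set ψ := cd.implicitFunction hn hinv with hψ
  have h0 : ψ u.1 = u.2 := cd.implicitFunction_apply_self hn hinv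
  have hs : ContDiffAt ℝ ∞ ψ u.1 := cd.contDiffAt_implicitFunction hn hinv
  have hap : ∀ᶠ x in 𝓝 u.1, Φ (x, ψ x) = Φ u := cd.eventually_apply_implicitFunction hn hinv
  have hiff : ∀ᶠ v in 𝓝 u, Φ v = Φ u ↔ ψ v.1 = v.2 :=
    cd.eventually_apply_eq_iff_implicitFunction hn hinv
  refine ⟨ψ, h0, ?_, hap, hiff, (cd.hasStrictFDerivAt_implicitFunction hn hinv).hasFDerivAt⟩
  have hc : ∀ᶠ x in 𝓝 u.1, ContinuousAt ψ x :=
    ((hs.of_le (m := 1) (by simp)).eventually (by simp)).mono fun x hx ↦ hx.continuousAt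
  have hpair : ContinuousAt (fun x ↦ (x, ψ x)) u.1 := continuousAt_id.prodMk hc.self_of_nhds
  have hcont : ContinuousAt (fun x ↦ fderiv ℝ Φ (x, ψ x) ∘L .inr ℝ E₁ E₂) u.1 := by
    have h1 : ContinuousAt (fderiv ℝ Φ) (u.1, ψ u.1) :=
      (hΦ.continuous_fderiv hn).continuousAt
    exact (ContinuousAt.comp (f := fun x ↦ (x, ψ x)) h1 hpair).clm_comp continuousAt_const
  have hI : ∀ᶠ x in 𝓝 u.1, (fderiv ℝ Φ (x, ψ x) ∘L .inr ℝ E₁ E₂).IsInvertible := by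
    obtain ⟨e, he⟩ := hinv
    have : range ((↑) : (E₂ ≃L[ℝ] F) → E₂ →L[ℝ] F) ∈
        𝓝 (fderiv ℝ Φ (u.1, ψ u.1) ∘L .inr ℝ E₁ E₂) := by
      rw [h0, Prod.mk.eta, ← he]; exact e.nhds
    exact hcont this
  -- `ContDiffAt ℝ ∞` at one point does not spread to a neighbourhood. The theorem is applied afresh
  -- at each nearby `(x, ψ x)`: by local uniqueness `ψ` coincides near `x` with an implicit function
  -- that is smooth at `x`.
  filter_upwards [hap.eventually_nhds, hc, hI] with x hx hcx hIx
  have cdx := hΦ.contDiffAt (x := (x, ψ x))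
  have h1 := cdx.eventually_apply_eq_iff_implicitFunction hn hIx
  have h2 : ContDiffAt ℝ ∞ (cdx.implicitFunction hn hIx) x := cdx.contDiffAt_implicitFunction hn hIx
  refine h2.congr_of_eventuallyEq ?_
  have hpx : Tendsto (fun y ↦ (y, ψ y)) (𝓝 x) (𝓝 (x, ψ x)) :=
    (continuousAt_id.prodMk hcx : ContinuousAt (fun y ↦ (y, ψ y)) x)
  filter_upwards [hx, hpx.eventually h1] with y hy1 hy2
  exact (hy2.1 (hy1.trans hx.self_of_nhds.symm)).symm

end ImplicitFunction

/-! ### Integration as an operator on continuous functions on the unit interval -/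

namespace ContinuousMap

open unitInterval MeasureTheory

theorem continuous_comp_projIcc {E : Type*} [TopologicalSpace E] (w : C(I, E)) :
    Continuous fun s : ℝ ↦ w (projIcc 0 1 zero_le_one s) :=
  w.continuous.comp continuous_projIcc

variable {E : Type*} [NormedAddCommGroup E] [NormedSpace ℝ E]

/-- The primitive, vanishing at `0`, of a continuous function on the unit interval. -/
noncomputable def primitiveFun (w : C(I, E)) (t : ℝ) : E :=
  ∫ s in (0 : ℝ)..t, w (projIcc 0 1 zero_le_one s)

theorem hasDerivAt_primitiveFun [CompleteSpace E] (w : C(I, E)) (t : ℝ) :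
    HasDerivAt (primitiveFun w) (w (projIcc 0 1 zero_le_one t)) t :=
  (w.continuous_comp_projIcc.integral_hasStrictDerivAt 0 t).hasDerivAt

theorem norm_primitiveFun_le (w : C(I, E)) (t : I) : ‖primitiveFun w t‖ ≤ ‖w‖ := by
  refine (intervalIntegral.norm_integral_le_of_norm_le_const
    (C := ‖w‖) fun s _ ↦ w.norm_coe_le_norm _).trans ?_
  rw [sub_zero, abs_of_nonneg t.2.1]
  exact mul_le_of_le_one_right (norm_nonneg _) t.2.2

theorem continuous_primitiveFun [CompleteSpace E] (w : C(I, E)) : Continuous (primitiveFun w) :=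
  continuous_iff_continuousAt.2 fun t ↦ (hasDerivAt_primitiveFun w t).continuousAt

/-- Integration from `0`, as an operator on the continuous functions on the unit interval. -/
noncomputable def primitive [CompleteSpace E] : C(I, E) →L[ℝ] C(I, E) :=
  LinearMap.mkContinuous
    { toFun := fun w ↦ ⟨fun t ↦ primitiveFun w t,
        (continuous_primitiveFun w).comp continuous_subtype_val⟩
      map_add' := fun w w' ↦ by
        ext t
        exact intervalIntegral.integral_add (w.continuous_comp_projIcc.intervalIntegrable _ _)
          (w'.continuous_comp_projIcc.intervalIntegrable _ _)
      map_smul' := fun c w ↦ by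
        ext t
        exact intervalIntegral.integral_smul c _ } 1 fun w ↦ by
    rw [one_mul, ContinuousMap.norm_le _ (norm_nonneg _)]
    exact norm_primitiveFun_le w

theorem primitive_apply [CompleteSpace E] (w : C(I, E)) (t : I) :
    primitive w t = primitiveFun w t := rfl

/-- Rescaling of the variable by a factor in the unit interval. -/
theorem primitiveFun_rescale {w w' : C(I, E)} {b : ℝ} {τ : I}
    (hw : ∀ s : I, w' s = (τ * b : ℝ) • w (τ * s)) (t : I) :
    primitiveFun w' t = b • primitiveFun w (τ * t) := by
  have h1 : primitiveFun w' t
      = ∫ s in (0 : ℝ)..t, (τ * b : ℝ) • w (projIcc 0 1 zero_le_one ((τ : ℝ) * s)) := by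
    refine intervalIntegral.integral_congr fun s hs ↦ ?_
    rw [uIcc_of_le t.2.1] at hs
    have hs1 : s ∈ Icc (0 : ℝ) 1 := ⟨hs.1, hs.2.trans t.2.2⟩
    have hs2 : (τ : ℝ) * s ∈ Icc (0 : ℝ) 1 :=
      ⟨mul_nonneg τ.2.1 hs1.1, mul_le_one₀ τ.2.2 hs1.1 hs1.2⟩
    simp only [projIcc_of_mem zero_le_one hs1, projIcc_of_mem zero_le_one hs2, hw]
    rfl
  have h2 := intervalIntegral.smul_integral_comp_mul_left
    (fun s ↦ w (projIcc 0 1 zero_le_one s)) (τ : ℝ) (a := 0) (b := t)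
  rw [h1, intervalIntegral.integral_smul, mul_comm, mul_smul, h2, mul_zero]
  rfl

/-- Constant functions, as a continuous linear map. -/
noncomputable def constCLM : E →L[ℝ] C(I, E) :=
  LinearMap.mkContinuous
    { toFun := fun v ↦ ContinuousMap.const I v
      map_add' := fun _ _ ↦ rfl
      map_smul' := fun _ _ ↦ rfl } 1 fun v ↦ by
    rw [one_mul, ContinuousMap.norm_le _ (norm_nonneg _)]
    exact fun _ ↦ le_rfl

@[simp]
theorem constCLM_apply (v : E) (t : I) : constCLM v t = v := rfl

end ContinuousMap

/-! ### Derivatives along rays from the origin -/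

section Ray

variable {E F : Type*} [NormedAddCommGroup E] [NormedSpace ℝ E] [NormedAddCommGroup F]
  [NormedSpace ℝ F]

theorem HasFDerivAt.hasDerivAt_ray {g : E → F} {g' : E →L[ℝ] F} {v : E} {t : ℝ}
    (hg : HasFDerivAt g g' (t • v)) : HasDerivAt (fun s : ℝ ↦ g (s • v)) (g' v) t := by
  have hl : HasDerivAt (fun s : ℝ ↦ s • v) v t := by
    simpa using (hasDerivAt_id t).smul_const v
  exact HasFDerivAt.comp_hasDerivAt (f := fun s : ℝ ↦ s • v) t hg hl

theorem HasFDerivAt.hasDerivAt_ray_apply {T : E → E →L[ℝ] F} {T' : E →L[ℝ] E →L[ℝ] F} {v : E}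
    {t : ℝ} (hT : HasFDerivAt T T' (t • v)) (u : E) :
    HasDerivAt (fun s : ℝ ↦ T (s • v) u) (T' v u) t :=
  (ContinuousLinearMap.apply ℝ F u).hasFDerivAt.comp_hasDerivAt t hT.hasDerivAt_ray

end Ray

/-! ### Second order equations that are quadratic in the velocity -/

section RadialSolution

open ContinuousMap unitInterval

variable {E : Type*} [NormedAddCommGroup E] [NormedSpace ℝ E]

/-- Along any line through `(y, 0)` the velocity component is proportional to `t`, so `f` has a
factor `t²` there. This is what makes the linearised equation at rest trivial. -/
theorem fderiv_eq_zero_of_homogeneous {f : E × E → E} (hf : ContDiff ℝ ∞ f)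
    (hom : ∀ (y v : E) (t : ℝ), f (y, t • v) = t ^ 2 • f (y, v)) (y : E) :
    fderiv ℝ f (y, 0) = 0 := by
  refine ContinuousLinearMap.ext fun q ↦ ?_
  have hd : Differentiable ℝ f := hf.differentiable (by simp)
  have h1 : HasDerivAt (fun t : ℝ ↦ f ((y, 0) + t • q)) (fderiv ℝ f (y, 0) q) 0 := by
    have hl : HasDerivAt (fun t : ℝ ↦ ((y, 0) : E × E) + t • q) q 0 := by
      simpa using ((hasDerivAt_id (0 : ℝ)).smul_const q).const_add ((y, 0) : E × E)
    have := (hd ((y, 0) + (0 : ℝ) • q)).hasFDerivAt.comp_hasDerivAt (0 : ℝ) hl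
    simpa [Function.comp_def] using this
  have h2 : HasDerivAt (fun t : ℝ ↦ t ^ 2 • f (y + t • q.1, q.2)) 0 0 := by
    have hg : DifferentiableAt ℝ (fun t : ℝ ↦ f (y + t • q.1, q.2)) 0 := by
      refine (hd _).comp (0 : ℝ) ?_
      fun_prop
    simpa using (hasDerivAt_pow 2 (0 : ℝ)).fun_smul hg.hasDerivAt
  have h3 : (fun t : ℝ ↦ f ((y, 0) + t • q)) = fun t : ℝ ↦ t ^ 2 • f (y + t • q.1, q.2) := by
    ext t
    rw [← hom]
    simp [Prod.add_def]
  rw [h3] at h1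
  simpa using h1.unique h2

/-- The equation for the curves `t ↦ 𝓔 (t v)`, from its validity for `0 < t < 1`. -/
theorem radial_equation_of_Ioo {f : E × E → E} (hf : Continuous f)
    (hom : ∀ (y v : E) (t : ℝ), f (y, t • v) = t ^ 2 • f (y, v)) {r : ℝ} {𝓔 : E → E}
    (hsm : ContDiffOn ℝ ∞ 𝓔 (ball 0 r))
    (hode : ∀ v ∈ ball (0 : E) r, ∀ t ∈ Ioo (0 : ℝ) 1,
      fderiv ℝ (fderiv ℝ 𝓔) (t • v) v v = f (𝓔 (t • v), fderiv ℝ 𝓔 (t • v) v))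
    (v : E) (t : ℝ) (htv : t • v ∈ ball (0 : E) r) :
    fderiv ℝ (fderiv ℝ 𝓔) (t • v) v v = f (𝓔 (t • v), fderiv ℝ 𝓔 (t • v) v) := by
  have hDs : ContDiffOn ℝ ∞ (fderiv ℝ 𝓔) (ball 0 r) :=
    hsm.fderiv_of_isOpen isOpen_ball (by simp)
  have hne : ∀ (v : E) (t : ℝ), t ≠ 0 → t • v ∈ ball (0 : E) r →
      fderiv ℝ (fderiv ℝ 𝓔) (t • v) v v = f (𝓔 (t • v), fderiv ℝ 𝓔 (t • v) v) := by
    intro v t ht hv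
    -- The point `t v` is reached at a time `τ < 1` by the ray of `τ⁻¹ t v`, which still lies in the
    -- ball when `τ` is close to `1`. Both sides of the equation scale by `(τ⁻¹ t)²`, which is
    -- nonzero and cancels.
    have hc : ContinuousAt (fun τ : ℝ ↦ τ⁻¹ • t • v) 1 :=
      (continuousAt_inv₀ one_ne_zero).smul continuousAt_const
    have hev : ∀ᶠ τ in 𝓝 (1 : ℝ), τ⁻¹ • t • v ∈ ball (0 : E) r :=
      hc.eventually (isOpen_ball.mem_nhds (by simpa using hv))
    obtain ⟨τ, hτ1, hτ2⟩ := ((hev.filter_mono nhdsWithin_le_nhds).and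
      (Ioo_mem_nhdsLT (zero_lt_one' ℝ))).exists
    have h1 := hode _ hτ1 τ hτ2
    have hτ0 : τ ≠ 0 := hτ2.1.ne'
    rw [smul_inv_smul₀ hτ0, smul_smul] at h1
    set k := τ⁻¹ * t with hk
    have hk0 : k ≠ 0 := mul_ne_zero (inv_ne_zero hτ0) ht
    simp only [map_smul, _root_.smul_apply, hom, smul_smul, ← sq] at h1
    exact smul_right_injective E (pow_ne_zero 2 hk0) h1
  rcases eq_or_ne t 0 with rfl | ht
  · have hz : (0 : ℝ) • v = 0 := zero_smul ℝ v
    have h0r : (0 : ℝ) • v ∈ ball (0 : E) r := htv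
    have hl : ContinuousAt (fun s : ℝ ↦ s • v) 0 := (continuous_id.smul continuous_const).continuousAt
    have hcD : ContinuousAt (fun s : ℝ ↦ fderiv ℝ 𝓔 (s • v) v) 0 :=
      (ContinuousAt.comp (f := fun s : ℝ ↦ s • v) (hDs.contDiffAt (isOpen_ball.mem_nhds h0r)).continuousAt hl).clm_apply
        continuousAt_const
    have hDDs : ContDiffOn ℝ ∞ (fderiv ℝ (fderiv ℝ 𝓔)) (ball 0 r) :=
      hDs.fderiv_of_isOpen isOpen_ball (by simp)
    have hcDD : ContinuousAt (fun s : ℝ ↦ fderiv ℝ (fderiv ℝ 𝓔) (s • v) v v) 0 :=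
      ((ContinuousAt.comp (f := fun s : ℝ ↦ s • v)
        (hDDs.contDiffAt (isOpen_ball.mem_nhds h0r)).continuousAt hl).clm_apply
        continuousAt_const).clm_apply continuousAt_const
    have hcE : ContinuousAt (fun s : ℝ ↦ 𝓔 (s • v)) 0 :=
      ContinuousAt.comp (f := fun s : ℝ ↦ s • v) (hsm.contDiffAt (isOpen_ball.mem_nhds h0r)).continuousAt hl
    have hcf : ContinuousAt (fun s : ℝ ↦ f (𝓔 (s • v), fderiv ℝ 𝓔 (s • v) v)) 0 :=
      ContinuousAt.comp (f := fun s : ℝ ↦ (𝓔 (s • v), fderiv ℝ 𝓔 (s • v) v))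
        hf.continuousAt (hcE.prodMk hcD)
    -- At `t = 0` the scaling argument fails; the equation is the limit of its instances at nonzero
    -- times.
    refine tendsto_nhds_unique (l := 𝓝[≠] (0 : ℝ)) (hcDD.tendsto.mono_left nhdsWithin_le_nhds) ?_
    refine (hcf.tendsto.mono_left nhdsWithin_le_nhds).congr' ?_
    filter_upwards [self_mem_nhdsWithin, nhdsWithin_le_nhds
      (hl.eventually (isOpen_ball.mem_nhds h0r))] with s hs0 hsr
    exact (hne v s hs0 hsr).symm
  · exact hne v t ht htv

variable [CompleteSpace E]

/-- The velocity of the path with initial velocity `v` and acceleration `w`. -/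
noncomputable def velocityCLM : E × C(I, E) →L[ℝ] C(I, E) :=
  constCLM ∘L .fst ℝ E C(I, E) + primitive ∘L .snd ℝ E C(I, E)

/-- The path with velocity `u` issued from `0`, together with its velocity. -/
noncomputable def jetCLM : C(I, E) →L[ℝ] C(I, E × E) :=
  (ContinuousLinearMap.inl ℝ E E).compLeftContinuous ℝ I ∘L primitive +
    (ContinuousLinearMap.inr ℝ E E).compLeftContinuous ℝ I

theorem velocityCLM_apply (q : E × C(I, E)) (t : I) :
    velocityCLM q t = q.1 + primitiveFun q.2 t := rfl

theorem jetCLM_apply (u : C(I, E)) (t : I) : jetCLM u t = (primitiveFun u t, u t) := by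
  simp [jetCLM, primitive_apply]

/-- The defect of the second order equation `c'' = f (c, c')` for the path issued from `y` with
initial velocity `q.1` and acceleration `q.2`. -/
noncomputable def odeDefect (f : C(E × E, E)) (y : E) (q : E × C(I, E)) : C(I, E) :=
  q.2 - f.comp (ContinuousMap.const I (y, 0) + jetCLM (velocityCLM q))

theorem odeDefect_eq_zero_iff (f : C(E × E, E)) (y : E) (q : E × C(I, E)) :
    odeDefect f y q = 0 ↔
      ∀ t : I, q.2 t = f (y + primitiveFun (velocityCLM q) t, velocityCLM q t) := by
  rw [odeDefect, sub_eq_zero, ContinuousMap.ext_iff]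
  simp [jetCLM_apply]

theorem contDiff_odeDefect {f : E × E → E} (hf : ContDiff ℝ ∞ f) (y : E) :
    ContDiff ℝ ∞ (odeDefect ⟨f, hf.continuous⟩ y) := by
  refine contDiff_snd.sub ((contDiff_comp_left (X := I) hf).comp ?_)
  exact contDiff_const.add (jetCLM ∘L velocityCLM : E × C(I, E) →L[ℝ] C(I, E × E)).contDiff

/-- Zero data give the constant path at `y`, along which `f` has zero derivative. Only the
acceleration term survives, so the partial derivative in the acceleration is the identity and that
in the velocity is zero. -/
theorem fderiv_odeDefect {f : E × E → E} (hf : ContDiff ℝ ∞ f)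
    (hom : ∀ (y v : E) (t : ℝ), f (y, t • v) = t ^ 2 • f (y, v)) (y : E) :
    fderiv ℝ (odeDefect ⟨f, hf.continuous⟩ y) 0 = .snd ℝ E C(I, E) := by
  have h1 := hasFDerivAt_comp_left_of_fderiv_eq_zero (X := I) (hf.of_le (m := 1) (by simp))
    (ContinuousMap.const I ((y, 0) : E × E) + jetCLM (velocityCLM (0 : E × C(I, E))))
    (fun t ↦ by simpa using fderiv_eq_zero_of_homogeneous hf hom y)
  have h2 : HasFDerivAt (fun q : E × C(I, E) ↦
      (ContinuousMap.const I (y, 0) : C(I, E × E)) + jetCLM (velocityCLM q))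
      (jetCLM ∘L velocityCLM) 0 :=
    (jetCLM ∘L velocityCLM : E × C(I, E) →L[ℝ] C(I, E × E)).hasFDerivAt.const_add _
  have h3 := (hasFDerivAt_snd (𝕜 := ℝ) (p := (0 : E × C(I, E)))).sub
    (HasFDerivAt.comp (0 : E × C(I, E)) h1 h2)
  rw [ContinuousLinearMap.zero_comp, sub_zero] at h3
  exact h3.fderiv

/-- If `c` solves the equation then so does `t ↦ c (τ t)`: its velocity gains a factor `τ` and its
acceleration `τ²`, matching the homogeneity of `f`. -/
theorem odeDefect_rescale {f : C(E × E, E)}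
    (hom : ∀ (y v : E) (t : ℝ), f (y, t • v) = t ^ 2 • f (y, v)) {y : E} {v : E} {w w' : C(I, E)}
    (h : odeDefect f y (v, w) = 0) {τ : I}
    (hw : ∀ s, w' s = ((τ : ℝ) ^ 2) • w (τ * s)) :
    odeDefect f y ((τ : ℝ) • v, w') = 0 ∧
      ∀ t : I, primitiveFun (velocityCLM ((τ : ℝ) • v, w')) t
        = primitiveFun (velocityCLM (v, w)) (τ * t) := by
  rw [odeDefect_eq_zero_iff] at h ⊢
  have hu : ∀ s : I, velocityCLM ((τ : ℝ) • v, w') s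
      = ((τ : ℝ) * 1) • velocityCLM (v, w) (τ * s) := fun s ↦ by
    rw [velocityCLM_apply, velocityCLM_apply, mul_one, smul_add]
    congr 1
    exact primitiveFun_rescale (fun s ↦ by rw [hw, sq]) s
  have hp : ∀ t : I, primitiveFun (velocityCLM ((τ : ℝ) • v, w')) t
      = primitiveFun (velocityCLM (v, w)) (τ * t) := fun t ↦ by
    rw [primitiveFun_rescale hu, one_smul]
  refine ⟨fun t ↦ ?_, hp⟩
  rw [hp, hu, mul_one, hom, hw]
  congr 1
  exact h (τ * t)

/-- Local solution, by a family of paths that depends smoothly on the initial velocity, of a second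
order equation that is homogeneous of degree two in the velocity. -/
theorem exists_path_family {f : E × E → E} (hf : ContDiff ℝ ∞ f)
    (hom : ∀ (y v : E) (t : ℝ), f (y, t • v) = t ^ 2 • f (y, v)) (y : E) :
    ∃ r > 0, ∃ ψ : E → C(I, E), ψ 0 = 0 ∧ ContDiffOn ℝ ∞ ψ (ball 0 r) ∧ HasFDerivAt ψ (0 : E →L[ℝ] C(I, E)) 0 ∧
      ∀ v ∈ ball (0 : E) r,
        (∀ t : I, ψ v t
          = f (y + primitiveFun (velocityCLM (v, ψ v)) t, velocityCLM (v, ψ v) t)) ∧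
        ∀ τ : I, primitiveFun (velocityCLM ((τ : ℝ) • v, ψ ((τ : ℝ) • v))) 1
          = primitiveFun (velocityCLM (v, ψ v)) τ := by
  have hfd := fderiv_odeDefect hf hom y
  have hinv : fderiv ℝ (odeDefect ⟨f, hf.continuous⟩ y) 0 ∘L .inr ℝ E C(I, E)
      = .id ℝ C(I, E) := by
    rw [hfd, ContinuousLinearMap.snd_comp_inr]
  obtain ⟨ψ, h0, hs, hap, hiff, hd⟩ := (contDiff_odeDefect hf y).exists_implicitFunction 0
    (by rw [hinv]; exact ⟨.refl ℝ _, rfl⟩)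
  have hz : odeDefect ⟨f, hf.continuous⟩ y (0 : E × C(I, E)) = 0 := by
    rw [odeDefect_eq_zero_iff]
    intro t
    have : f (y, 0) = 0 := by simpa using hom y 0 0
    simp [this, primitiveFun]
  rw [hz] at hap hiff
  rw [hfd, ContinuousLinearMap.snd_comp_inl, ContinuousLinearMap.comp_zero] at hd
  change ψ 0 = 0 at h0
  replace hd : HasFDerivAt ψ (0 : E →L[ℝ] C(I, E)) 0 := by simpa using hd
  obtain ⟨r₁, hr₁, hball⟩ := Metric.eventually_nhds_iff_ball.1 hiff
  have hsmall : ∀ᶠ v in 𝓝 (0 : E), ψ v ∈ ball 0 r₁ := by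
    have := hd.continuousAt
    exact this.eventually (h0 ▸ ball_mem_nhds (0 : C(I, E)) hr₁)
  obtain ⟨r₂, hr₂, hball₂⟩ := Metric.eventually_nhds_iff_ball.1 (hs.and (hap.and hsmall))
  refine ⟨min r₁ r₂, lt_min hr₁ hr₂, ψ, h0, fun v hv ↦ ?_, hd, fun v hv ↦ ?_⟩
  · exact (hball₂ v (ball_subset_ball (min_le_right _ _) hv)).1.contDiffWithinAt
  · obtain ⟨-, hv2, hv3⟩ := hball₂ v (ball_subset_ball (min_le_right _ _) hv)
    refine ⟨(odeDefect_eq_zero_iff _ _ _).1 hv2, fun τ ↦ ?_⟩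
    -- This is the acceleration of the path run at speed `τ`. Since `|τ| ≤ 1`, the pair `(τ v, w')`
    -- stays in the ball where every solution is on the graph of `ψ`; hence `w' = ψ (τ v)`.
    set w' : C(I, E) := ((τ : ℝ) ^ 2) • (ψ v).comp ⟨fun s ↦ τ * s, by fun_prop⟩ with hw'
    obtain ⟨h1, h2⟩ := odeDefect_rescale hom hv2 (w' := w') (τ := τ) (fun s ↦ by simp [hw'])
    have hτ1 : |(τ : ℝ)| ≤ 1 := by rw [abs_of_nonneg τ.2.1]; exact τ.2.2
    have hmem : ((τ : ℝ) • v, w') ∈ ball (0 : E × C(I, E)) r₁ := by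
      rw [mem_ball_zero_iff, Prod.norm_def, max_lt_iff]
      have hvn : ‖v‖ < r₁ := (mem_ball_zero_iff.1 hv).trans_le (min_le_left _ _)
      constructor
      · refine lt_of_le_of_lt ?_ hvn
        rw [norm_smul]
        exact mul_le_of_le_one_left (norm_nonneg _) hτ1
      · refine lt_of_le_of_lt ?_ (mem_ball_zero_iff.1 hv3)
        rw [ContinuousMap.norm_le _ (norm_nonneg _)]
        intro s
        rw [hw', ContinuousMap.smul_apply, norm_smul, norm_pow]
        exact (mul_le_of_le_one_left (norm_nonneg _) (pow_le_one₀ (norm_nonneg _) hτ1)).trans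
          ((ψ v).norm_coe_le_norm _)
    have h3 := (hball _ hmem).1 h1
    have h4 := h2 1
    dsimp only at h3
    rw [← h3] at h4
    simpa using h4

/-- The radial form of `exists_path_family`: there is a smooth map `𝓔` with `D𝓔(0) = id` such that
all the curves `t ↦ 𝓔 (t v)` solve `c'' = f (c, c')`. -/
theorem exists_radial_solution {f : E × E → E} (hf : ContDiff ℝ ∞ f)
    (hom : ∀ (y v : E) (t : ℝ), f (y, t • v) = t ^ 2 • f (y, v)) (y : E) :
    ∃ r > 0, ∃ 𝓔 : E → E, 𝓔 0 = y ∧ ContDiffOn ℝ ∞ 𝓔 (ball 0 r) ∧ HasFDerivAt 𝓔 (.id ℝ E) 0 ∧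
      ∀ (v : E) (t : ℝ), t • v ∈ ball (0 : E) r →
        fderiv ℝ (fderiv ℝ 𝓔) (t • v) v v = f (𝓔 (t • v), fderiv ℝ 𝓔 (t • v) v) := by
  obtain ⟨r, hr, ψ, h0, hs, hd, hψ⟩ := exists_path_family hf hom y
  set P : E × C(I, E) →L[ℝ] E := ContinuousMap.evalCLM ℝ (1 : I) ∘L primitive ∘L velocityCLM with hP
  have hPa : ∀ q, P q = primitiveFun (velocityCLM q) 1 := fun q ↦ rfl
  have hsm : ContDiffOn ℝ ∞ (fun v ↦ y + P (v, ψ v)) (ball 0 r) :=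
    contDiffOn_const.add (P.contDiff.comp_contDiffOn (contDiffOn_id.prodMk hs))
  set 𝓔 : E → E := fun v ↦ y + P (v, ψ v) with h𝓔
  have hDs : ContDiffOn ℝ ∞ (fderiv ℝ 𝓔) (ball 0 r) :=
    hsm.fderiv_of_isOpen isOpen_ball (by simp)
  have hdiff : ∀ x ∈ ball (0 : E) r, DifferentiableAt ℝ 𝓔 x := fun x hx ↦
    (hsm.contDiffAt (isOpen_ball.mem_nhds hx)).differentiableAt (by simp)
  have hdiff2 : ∀ x ∈ ball (0 : E) r, DifferentiableAt ℝ (fderiv ℝ 𝓔) x := fun x hx ↦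
    (hDs.contDiffAt (isOpen_ball.mem_nhds hx)).differentiableAt (by simp)
  have hray : ∀ v ∈ ball (0 : E) r, ∀ t ∈ Ioc (0 : ℝ) 1,
      𝓔 (t • v) = y + primitiveFun (velocityCLM (v, ψ v)) t := by
    intro v hv t ht
    have := (hψ v hv).2 ⟨t, ht.1.le, ht.2⟩
    simp only [h𝓔, hPa]
    rw [← this]
  have hmem : ∀ v ∈ ball (0 : E) r, ∀ t ∈ Ioo (0 : ℝ) 1, t • v ∈ ball (0 : E) r := by
    intro v hv t ht
    rw [mem_ball_zero_iff] at hv ⊢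
    rw [norm_smul, Real.norm_of_nonneg ht.1.le]
    exact (mul_le_of_le_one_left (norm_nonneg _) ht.2.le).trans_lt hv
  have hvel : ∀ v ∈ ball (0 : E) r, ∀ t ∈ Ioo (0 : ℝ) 1,
      fderiv ℝ 𝓔 (t • v) v = v + primitiveFun (ψ v) t := by
    intro v hv t ht
    have h1 := (hdiff _ (hmem v hv t ht)).hasFDerivAt.hasDerivAt_ray
    have h2 := (hasDerivAt_primitiveFun (velocityCLM (v, ψ v)) t).const_add y
    have h3 : (fun s : ℝ ↦ 𝓔 (s • v)) =ᶠ[𝓝 t]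
        fun s ↦ y + primitiveFun (velocityCLM (v, ψ v)) s := by
      filter_upwards [isOpen_Ioo.mem_nhds ht] with s hs
      exact hray v hv s (Ioo_subset_Ioc_self hs)
    have h4 := h1.unique (h2.congr_of_eventuallyEq h3)
    rw [h4, projIcc_of_mem zero_le_one (Ioo_subset_Icc_self ht), velocityCLM_apply]
  have hode : ∀ v ∈ ball (0 : E) r, ∀ t ∈ Ioo (0 : ℝ) 1,
      fderiv ℝ (fderiv ℝ 𝓔) (t • v) v v = f (𝓔 (t • v), fderiv ℝ 𝓔 (t • v) v) := by
    intro v hv t ht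
    have h1 := (hdiff2 _ (hmem v hv t ht)).hasFDerivAt.hasDerivAt_ray_apply v
    have h2 := (hasDerivAt_primitiveFun (ψ v) t).const_add v
    have h3 : (fun s : ℝ ↦ fderiv ℝ 𝓔 (s • v) v) =ᶠ[𝓝 t] fun s ↦ v + primitiveFun (ψ v) s := by
      filter_upwards [isOpen_Ioo.mem_nhds ht] with s hs
      exact hvel v hv s hs
    have h4 := h1.unique (h2.congr_of_eventuallyEq h3)
    have hproj := projIcc_of_mem zero_le_one (Ioo_subset_Icc_self ht)
    rw [hvel v hv t ht, hray v hv t (Ioo_subset_Ioc_self ht)]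
    have h5 := (hψ v hv).1 ⟨t, Ioo_subset_Icc_self ht⟩
    rw [velocityCLM_apply] at h5
    rw [← h5]
    simpa [hproj] using h4
  have hP0 : P ((0 : E), (0 : C(I, E))) = 0 := P.map_zero
  refine ⟨r, hr, 𝓔, by simp [h𝓔, h0, hP0], hsm, ?_, fun v t htv ↦ ?_⟩
  -- As `ψ` has zero derivative at `0`, the first order part of `𝓔` comes from constant velocity
  -- `v`, whose displacement at time `1` is `v`.
  · have h1 : HasFDerivAt (fun v ↦ (v, ψ v)) ((ContinuousLinearMap.id ℝ E).prod 0) 0 :=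
      (hasFDerivAt_id 0).prodMk hd
    have h2 := (P.hasFDerivAt.comp (0 : E) h1).const_add y
    refine h2.congr_fderiv (ContinuousLinearMap.ext fun v ↦ ?_)
    change primitiveFun (velocityCLM (v, (0 : C(I, E)))) 1 = v
    have h4 : velocityCLM (v, (0 : C(I, E))) = constCLM v := by
      ext t
      simp [velocityCLM_apply, primitiveFun]
    simp [h4, primitiveFun]
  · exact radial_equation_of_Ioo hf.continuous hom hsm hode v t htv

end RadialSolution

/-! ### The Gauss lemma in coordinates -/

section GaussLemma

variable {E : Type*} [NormedAddCommGroup E] [NormedSpace ℝ E]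

theorem HasFDerivAt.hasDerivAt_apply {F : Type*} [NormedAddCommGroup F] [NormedSpace ℝ F]
    {T : E → E →L[ℝ] F} {T' : E →L[ℝ] E →L[ℝ] F} {c a : ℝ → E} {c' a' : E} {t : ℝ}
    (hT : HasFDerivAt T T' (c t)) (hc : HasDerivAt c c' t) (ha : HasDerivAt a a' t) :
    HasDerivAt (fun s ↦ T (c s) (a s)) (T' c' (a t) + T (c t) a') t :=
  (hT.comp_hasDerivAt t hc).clm_apply ha

theorem HasDerivAt.bilin_apply {G : E → E →L[ℝ] E →L[ℝ] ℝ} {G' : E →L[ℝ] E →L[ℝ] E →L[ℝ] ℝ}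
    {c a b : ℝ → E} {c' a' b' : E} {t : ℝ} (hG : HasFDerivAt G G' (c t)) (hc : HasDerivAt c c' t)
    (ha : HasDerivAt a a' t) (hb : HasDerivAt b b' t) :
    HasDerivAt (fun s ↦ G (c s) (a s) (b s))
      (G' c' (a t) (b t) + G (c t) a' (b t) + G (c t) (a t) b') t := by
  have h := ((hG.comp_hasDerivAt t hc).clm_apply ha).clm_apply hb
  simpa using h

theorem fderiv_symm_apply {G : E → E →L[ℝ] E →L[ℝ] ℝ} (hsymm : ∀ y a b, G y a b = G y b a) {y : E}
    (hG : DifferentiableAt ℝ G y) (c a b : E) : fderiv ℝ G y c a b = fderiv ℝ G y c b a := by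
  have h : ∀ a b, HasFDerivAt (fun z ↦ G z a b)
      ((ContinuousLinearMap.apply ℝ ℝ b ∘L ContinuousLinearMap.apply ℝ (E →L[ℝ] ℝ) a) ∘L
        fderiv ℝ G y) y := fun a b ↦
    (ContinuousLinearMap.apply ℝ ℝ b ∘L
      ContinuousLinearMap.apply ℝ (E →L[ℝ] ℝ) a).hasFDerivAt.comp y hG.hasFDerivAt
  have h1 := h b a
  rw [show (fun z ↦ G z b a) = fun z ↦ G z a b from funext fun z ↦ hsymm z b a] at h1
  exact congrArg (fun T : E →L[ℝ] ℝ ↦ T c) ((h a b).unique h1)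

/-- The hypotheses of the Gauss lemma in coordinates: the rays of `𝓔` satisfy the geodesic equation
of the metric `G`. -/
structure IsRadialGeodesicMap (G : E → E →L[ℝ] E →L[ℝ] ℝ) (𝓔 : E → E) (r : ℝ) : Prop where
  symm : ∀ y a b, G y a b = G y b a
  smooth : ContDiffOn ℝ ∞ 𝓔 (ball 0 r)
  hasFDerivAt_zero : HasFDerivAt 𝓔 (.id ℝ E) 0
  differentiableAt : ∀ x ∈ ball (0 : E) r, DifferentiableAt ℝ G (𝓔 x)
  geodesic : ∀ (v : E) (t : ℝ), t • v ∈ ball (0 : E) r → ∀ w : E,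
    G (𝓔 (t • v)) (fderiv ℝ (fderiv ℝ 𝓔) (t • v) v v) w
      + (fderiv ℝ G (𝓔 (t • v)) (fderiv ℝ 𝓔 (t • v) v) (fderiv ℝ 𝓔 (t • v) v) w
        - fderiv ℝ G (𝓔 (t • v)) w (fderiv ℝ 𝓔 (t • v) v) (fderiv ℝ 𝓔 (t • v) v) / 2) = 0

namespace IsRadialGeodesicMap

variable {G : E → E →L[ℝ] E →L[ℝ] ℝ} {𝓔 : E → E} {r : ℝ}

theorem hasFDerivAt (h : IsRadialGeodesicMap G 𝓔 r) {x : E} (hx : x ∈ ball (0 : E) r) :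
    HasFDerivAt 𝓔 (fderiv ℝ 𝓔 x) x :=
  ((h.smooth.contDiffAt (isOpen_ball.mem_nhds hx)).differentiableAt (by simp)).hasFDerivAt

theorem hasFDerivAt_fderiv (h : IsRadialGeodesicMap G 𝓔 r) {x : E} (hx : x ∈ ball (0 : E) r) :
    HasFDerivAt (fderiv ℝ 𝓔) (fderiv ℝ (fderiv ℝ 𝓔) x) x :=
  (((h.smooth.fderiv_of_isOpen isOpen_ball (m := ∞) (by simp)).contDiffAt
    (isOpen_ball.mem_nhds hx)).differentiableAt (by simp)).hasFDerivAt

theorem fderiv_fderiv_symm (h : IsRadialGeodesicMap G 𝓔 r) {x : E} (hx : x ∈ ball (0 : E) r)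
    (u v : E) : fderiv ℝ (fderiv ℝ 𝓔) x u v = fderiv ℝ (fderiv ℝ 𝓔) x v u :=
  ((h.smooth.contDiffAt (isOpen_ball.mem_nhds hx)).isSymmSndFDerivAt (by rw [minSmoothness_of_isRCLikeNormedField]; exact ENat.LEInfty.out)).eq u v

theorem smul_mem_ball {x : E} (hx : x ∈ ball (0 : E) r) {t : ℝ} (ht : t ∈ Icc (0 : ℝ) 1) :
    t • x ∈ ball (0 : E) r := by
  rw [mem_ball_zero_iff] at hx ⊢
  rw [norm_smul, Real.norm_of_nonneg ht.1]
  exact (mul_le_of_le_one_left (norm_nonneg _) ht.2).trans_lt hx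

/-- Geodesics have constant speed. -/
theorem energy (h : IsRadialGeodesicMap G 𝓔 r) {x : E} (hx : x ∈ ball (0 : E) r) :
    G (𝓔 x) (fderiv ℝ 𝓔 x x) (fderiv ℝ 𝓔 x x) = G (𝓔 0) x x := by
  have key : ∀ t ∈ Icc (0 : ℝ) 1, HasDerivAt
      (fun s : ℝ ↦ G (𝓔 (s • x)) (fderiv ℝ 𝓔 (s • x) x) (fderiv ℝ 𝓔 (s • x) x)) 0 t := by
    intro t ht
    have hm := smul_mem_ball hx ht
    have hG := (h.differentiableAt _ hm).hasFDerivAt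
    have hv := (h.hasFDerivAt_fderiv hm).hasDerivAt_ray_apply x
    have := HasDerivAt.bilin_apply (c := fun s : ℝ ↦ 𝓔 (s • x)) hG
      (h.hasFDerivAt hm).hasDerivAt_ray hv hv
    -- The derivative of the squared speed is twice the geodesic equation tested on the velocity
    -- itself.
    convert this using 1
    have hg := h.geodesic x t hm (fderiv ℝ 𝓔 (t • x) x)
    rw [h.symm _ (fderiv ℝ 𝓔 (t • x) x) (fderiv ℝ (fderiv ℝ 𝓔) (t • x) x x)]
    linarith
  have := constant_of_has_deriv_right_zero
    (fun t ht ↦ (key t ht).continuousAt.continuousWithinAt)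
    (fun t ht ↦ (key t (Ico_subset_Icc_self ht)).hasDerivWithinAt) 1 (right_mem_Icc.2 zero_le_one)
  simpa [h.hasFDerivAt_zero.fderiv] using this

/-- The derivative of the identity `energy` with respect to the initial velocity. -/
theorem fderiv_energy (h : IsRadialGeodesicMap G 𝓔 r) {z : E} (hz : z ∈ ball (0 : E) r) (u : E) :
    fderiv ℝ G (𝓔 z) (fderiv ℝ 𝓔 z u) (fderiv ℝ 𝓔 z z) (fderiv ℝ 𝓔 z z)
      + 2 * G (𝓔 z) (fderiv ℝ 𝓔 z z) (fderiv ℝ (fderiv ℝ 𝓔) z u z + fderiv ℝ 𝓔 z u)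
      = 2 * G (𝓔 0) z u := by
  have hl : HasDerivAt (fun s : ℝ ↦ z + s • u) u 0 := by
    simpa using ((hasDerivAt_id (0 : ℝ)).smul_const u).const_add z
  have hz0 : z + (0 : ℝ) • u = z := by simp
  have hz' : z + (0 : ℝ) • u ∈ ball (0 : E) r := by rwa [hz0]
  have hc : HasDerivAt (fun s : ℝ ↦ 𝓔 (z + s • u)) (fderiv ℝ 𝓔 z u) 0 := by
    have := (h.hasFDerivAt hz').comp_hasDerivAt (0 : ℝ) hl
    rwa [hz0] at this
  have hv : HasDerivAt (fun s : ℝ ↦ fderiv ℝ 𝓔 (z + s • u) (z + s • u))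
      (fderiv ℝ (fderiv ℝ 𝓔) z u z + fderiv ℝ 𝓔 z u) 0 := by
    have := HasFDerivAt.hasDerivAt_apply (c := fun s : ℝ ↦ z + s • u) (h.hasFDerivAt_fderiv hz')
      hl hl
    simpa only [hz0] using this
  have hG : HasFDerivAt G (fderiv ℝ G (𝓔 z)) ((fun s : ℝ ↦ 𝓔 (z + s • u)) 0) := by
    simpa [hz0] using (h.differentiableAt _ hz).hasFDerivAt
  have h1 := HasDerivAt.bilin_apply hG hc hv hv
  have h2 : HasDerivAt (fun s : ℝ ↦ G (𝓔 0) (z + s • u) (z + s • u))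
      (G (𝓔 0) u z + G (𝓔 0) z u) 0 := by
    have := ((hasDerivAt_const (0 : ℝ) (G (𝓔 0))).clm_apply hl).clm_apply hl
    simpa using this
  have h3 : (fun s : ℝ ↦ G (𝓔 (z + s • u)) (fderiv ℝ 𝓔 (z + s • u) (z + s • u))
      (fderiv ℝ 𝓔 (z + s • u) (z + s • u))) =ᶠ[𝓝 0]
      fun s : ℝ ↦ G (𝓔 0) (z + s • u) (z + s • u) := by
    filter_upwards [hl.continuousAt.eventually (isOpen_ball.mem_nhds hz')] with s hs
    exact h.energy hs
  have h4 := h1.unique (h2.congr_of_eventuallyEq h3)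
  simp only [zero_smul, add_zero] at h4
  rw [h.symm _ (fderiv ℝ (fderiv ℝ 𝓔) z u z + fderiv ℝ 𝓔 z u), h.symm _ u z] at h4
  linarith

/-- The Gauss lemma. -/
theorem gauss (h : IsRadialGeodesicMap G 𝓔 r) {x : E} (hx : x ∈ ball (0 : E) r) (u : E) :
    G (𝓔 x) (fderiv ℝ 𝓔 x x) (fderiv ℝ 𝓔 x u) = G (𝓔 0) x u := by
  have key : ∀ t ∈ Icc (0 : ℝ) 1, HasDerivAt
      (fun s : ℝ ↦ G (𝓔 (s • x)) (fderiv ℝ 𝓔 (s • x) x) (s • fderiv ℝ 𝓔 (s • x) u)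
        - s * G (𝓔 0) x u) 0 t := by
    intro t ht
    have hm := smul_mem_ball hx ht
    have hG := (h.differentiableAt _ hm).hasFDerivAt
    have hv := (h.hasFDerivAt_fderiv hm).hasDerivAt_ray_apply x
    have hu := (hasDerivAt_id t).fun_smul ((h.hasFDerivAt_fderiv hm).hasDerivAt_ray_apply u)
    have := (HasDerivAt.bilin_apply (c := fun s : ℝ ↦ 𝓔 (s • x)) hG
      (h.hasFDerivAt hm).hasDerivAt_ray hv hu).sub ((hasDerivAt_id t).mul_const (G (𝓔 0) x u))
    refine this.congr_deriv ?_
    have hg := h.geodesic x t hm (fderiv ℝ 𝓔 (t • x) u)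
    have hs := fderiv_symm_apply h.symm (h.differentiableAt _ hm)
    rcases eq_or_ne t 0 with rfl | ht0
    · simp [h.hasFDerivAt_zero.fderiv]
    · have he := h.fderiv_energy hm u
      rw [h.fderiv_fderiv_symm hm u] at he
      simp only [map_smul, map_add, smul_apply, smul_eq_mul, id, one_mul, one_smul] at he ⊢
      -- After multiplication by `2t`, the claim is the differentiated speed identity at `t x` plus
      -- `2t²` times the geodesic equation tested on `D𝓔(t x) u`. At `t = 0`, treated above, it is
      -- immediate.
      apply mul_left_cancel₀ (mul_ne_zero two_ne_zero ht0)
      linear_combination he + 2 * t ^ 2 * hg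
  have := constant_of_has_deriv_right_zero
    (fun t ht ↦ (key t ht).continuousAt.continuousWithinAt)
    (fun t ht ↦ (key t (Ico_subset_Icc_self ht)).hasDerivWithinAt) 1 (right_mem_Icc.2 zero_le_one)
  simpa [sub_eq_zero] using this

end IsRadialGeodesicMap

end GaussLemma

/-! ### Expansion of the spheres for small radii -/

section Expansion

variable {V : Type*} [NormedAddCommGroup V] [NormedSpace ℝ V]

/-- Near the origin, polar coordinates are expanding for any smooth metric. -/
theorem exists_radius_expanding {H : V → V →L[ℝ] V →L[ℝ] ℝ} {r : ℝ} (hr : 0 < r)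
    (hH : ContDiffOn ℝ ∞ H (ball 0 r)) (h0 : ∀ u, H 0 u u = ‖u‖ ^ 2) :
    ∃ δ > 0, δ ≤ r ∧ (∀ x ∈ ball (0 : V) δ, ∀ u ≠ 0, 0 < H x u u) ∧
      ∀ t ∈ Ioo 0 δ, ∀ v : V, ‖v‖ = 1 → ∀ u ≠ 0, 0 < deriv (fun s : ℝ ↦ s ^ 2 * H (s • v) u u) t := by
  have hat : ContDiffAt ℝ ∞ H 0 := hH.contDiffAt (isOpen_ball.mem_nhds (mem_ball_self hr))
  have hDs : ContDiffOn ℝ ∞ (fderiv ℝ H) (ball 0 r) := hH.fderiv_of_isOpen isOpen_ball (by simp)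
  have hDat : ContinuousAt (fderiv ℝ H) 0 :=
    (hDs.contDiffAt (isOpen_ball.mem_nhds (mem_ball_self hr))).continuousAt
  -- By continuity `C` bounds `DH` near `0`; the radius will be at most `1 / C`, so that `t C < 1`.
  set C := ‖fderiv ℝ H 0‖ + 1 with hC
  have hC0 : 0 < C := by positivity
  have h1 : ∀ᶠ x in 𝓝 (0 : V), ‖H x - H 0‖ < 1 / 2 := by
    have := hat.continuousAt.sub (continuousAt_const (y := H 0))
    have := this.norm
    rw [ContinuousAt, Pi.sub_apply, sub_self, norm_zero] at this
    exact this.eventually (gt_mem_nhds (by norm_num))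
  have h2 : ∀ᶠ x in 𝓝 (0 : V), ‖fderiv ℝ H x‖ < C :=
    hDat.norm.eventually (gt_mem_nhds (by rw [hC]; linarith))
  obtain ⟨r₁, hr₁, hb⟩ := Metric.eventually_nhds_iff_ball.1 (h1.and h2)
  have hlow : ∀ x ∈ ball (0 : V) r₁, ∀ u, ‖u‖ ^ 2 / 2 ≤ H x u u := by
    intro x hx u
    have h3 := (H x - H 0).le_opNorm₂ u u
    have h4 : ‖H x - H 0‖ * ‖u‖ * ‖u‖ ≤ 1 / 2 * ‖u‖ * ‖u‖ := by
      gcongr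
      exact (hb x hx).1.le
    rw [Real.norm_eq_abs] at h3
    have h5 := (abs_le.1 (h3.trans h4)).1
    have h6 : (H x - H 0) u u = H x u u - ‖u‖ ^ 2 := by rw [← h0]; rfl
    rw [h6] at h5
    linarith
  refine ⟨min r (min r₁ (1 / C)), by positivity, min_le_left _ _, fun x hx u hu ↦ ?_,
    fun t ht v hv u hu ↦ ?_⟩
  · have hx' : x ∈ ball (0 : V) r₁ :=
      ball_subset_ball ((min_le_right _ _).trans (min_le_left _ _)) hx
    have : 0 < ‖u‖ := norm_pos_iff.2 hu
    exact lt_of_lt_of_le (by positivity) (hlow x hx' u)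
  · have hu' : 0 < ‖u‖ := norm_pos_iff.2 hu
    have htr : t < r := ht.2.trans_le (min_le_left _ _)
    have htr₁ : t < r₁ := ht.2.trans_le ((min_le_right _ _).trans (min_le_left _ _))
    have htC : t * C < 1 := by
      rw [← lt_div_iff₀ hC0]
      exact ht.2.trans_le ((min_le_right _ _).trans (min_le_right _ _))
    have hn : ‖t • v‖ = t := by rw [norm_smul, hv, mul_one, Real.norm_of_nonneg ht.1.le]
    have hmr : t • v ∈ ball (0 : V) r := by rwa [mem_ball_zero_iff, hn]
    have hmr₁ : t • v ∈ ball (0 : V) r₁ := by rwa [mem_ball_zero_iff, hn]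
    have hd : HasFDerivAt H (fderiv ℝ H (t • v)) (t • v) :=
      ((hH.contDiffAt (isOpen_ball.mem_nhds hmr)).differentiableAt (by simp)).hasFDerivAt
    have hd' : HasDerivAt (fun s : ℝ ↦ H (s • v) u u) (fderiv ℝ H (t • v) v u u) t := by
      have := (hd.hasDerivAt_ray.clm_apply (hasDerivAt_const t u)).clm_apply (hasDerivAt_const t u)
      simpa using this
    -- The derivative is `2t H + t² (∂_v H)`. The first term is at least `t‖u‖²`, the second at
    -- least `-C t²‖u‖²`.
    rw [((hasDerivAt_pow 2 t).fun_mul hd').deriv]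
    have h3 : |fderiv ℝ H (t • v) v u u| ≤ C * ‖u‖ ^ 2 := by
      have h4 := (fderiv ℝ H (t • v) v).le_opNorm₂ u u
      have h5 := (fderiv ℝ H (t • v)).le_opNorm v
      rw [hv, mul_one] at h5
      calc |fderiv ℝ H (t • v) v u u| ≤ ‖fderiv ℝ H (t • v) v‖ * ‖u‖ * ‖u‖ := h4
        _ ≤ C * ‖u‖ * ‖u‖ := by gcongr; exact h5.trans (hb _ hmr₁).2.le
        _ = C * ‖u‖ ^ 2 := by ring
    have h6 := hlow _ hmr₁ u
    have h7 := (abs_le.1 h3).1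
    have ht0 := ht.1
    have h8 : t ^ 2 * (C * ‖u‖ ^ 2) < t * ‖u‖ ^ 2 := by
      have : t * ‖u‖ ^ 2 * (t * C) < t * ‖u‖ ^ 2 * 1 := by gcongr
      linarith
    have h9 : t ^ 2 * -(C * ‖u‖ ^ 2) ≤ t ^ 2 * fderiv ℝ H (t • v) v u u := by gcongr
    have h10 : t * (‖u‖ ^ 2 / 2) ≤ t * H (t • v) u u := by gcongr
    norm_num
    linarith

end Expansion

/-! ### Smooth families of bilinear forms on a manifold -/

section BilinearForms

variable {k : ℕ} {F : Type*} [TopologicalSpace F]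
  [ChartedSpace (EuclideanSpace ℝ (Fin k)) F] [IsManifold (𝓡 k) ∞ F]

/-- The local trivialization of the bundle of bilinear forms on the tangent spaces. -/
theorem trivializationAt_bilin_apply {x₀ x : F}
    (hx : x ∈ (trivializationAt (EuclideanSpace ℝ (Fin k)) (TangentSpace (𝓡 k)) x₀).baseSet)
    (φ : TangentSpace (𝓡 k) x →L[ℝ] TangentSpace (𝓡 k) x →L[ℝ] ℝ)
    (a b : EuclideanSpace ℝ (Fin k)) :
    (trivializationAt (EuclideanSpace ℝ (Fin k) →L[ℝ] EuclideanSpace ℝ (Fin k) →L[ℝ] ℝ)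
      (fun x : F ↦ TangentSpace (𝓡 k) x →L[ℝ] TangentSpace (𝓡 k) x →L[ℝ] ℝ) x₀ ⟨x, φ⟩).2 a b
    = φ ((trivializationAt (EuclideanSpace ℝ (Fin k)) (TangentSpace (𝓡 k)) x₀).symmL ℝ x a)
        ((trivializationAt (EuclideanSpace ℝ (Fin k)) (TangentSpace (𝓡 k)) x₀).symmL ℝ x b) := by
  rw [hom_trivializationAt_apply]
  simp only [ContinuousLinearMap.inCoordinates, ContinuousLinearMap.comp_apply]
  have hx2 : x ∈ (trivializationAt (EuclideanSpace ℝ (Fin k) →L[ℝ] ℝ)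
      (fun x : F ↦ TangentSpace (𝓡 k) x →L[ℝ] ℝ) x₀).baseSet := by
    rw [hom_trivializationAt_baseSet]
    exact ⟨hx, mem_univ _⟩
  rw [Trivialization.continuousLinearMapAt_apply, Trivialization.coe_linearMapAt_of_mem _ hx2]
  dsimp only
  rw [hom_trivializationAt_apply]
  simp [ContinuousLinearMap.inCoordinates]

/-- Pulling back a smooth family of bilinear forms of a vector space `V` by the derivative of a
smooth map `F → V` gives a smooth family of bilinear forms on `F`. -/
theorem contMDiffAt_pullback_bilin {V : Type*} [NormedAddCommGroup V] [NormedSpace ℝ V]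
    {EN HN N : Type*} [NormedAddCommGroup EN] [NormedSpace ℝ EN] [TopologicalSpace HN]
    {IN : ModelWithCorners ℝ EN HN} [TopologicalSpace N] [ChartedSpace HN N]
    {f : F → V} (hf : ContMDiff (𝓡 k) 𝓘(ℝ, V) ∞ f) {pr : N → F} {q₀ : N}
    (hpr : ContMDiffAt IN (𝓡 k) ∞ pr q₀) {B : N → V →L[ℝ] V →L[ℝ] ℝ}
    (hB : ContMDiffAt IN 𝓘(ℝ, V →L[ℝ] V →L[ℝ] ℝ) ∞ B q₀)
    {φ : ∀ q : N, TangentSpace (𝓡 k) (pr q) →L[ℝ] TangentSpace (𝓡 k) (pr q) →L[ℝ] ℝ}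
    (hφ : ∀ᶠ q in 𝓝 q₀, ∀ u w, φ q u w = B q (mvfderiv (𝓡 k) f (pr q) u) (mvfderiv (𝓡 k) f (pr q) w)) :
    ContMDiffAt IN
      ((𝓡 k).prod 𝓘(ℝ, EuclideanSpace ℝ (Fin k) →L[ℝ] EuclideanSpace ℝ (Fin k) →L[ℝ] ℝ)) ∞
      (fun q ↦ TotalSpace.mk' (EuclideanSpace ℝ (Fin k) →L[ℝ] EuclideanSpace ℝ (Fin k) →L[ℝ] ℝ)
        (E := fun x : F ↦ TangentSpace (𝓡 k) x →L[ℝ] TangentSpace (𝓡 k) x →L[ℝ] ℝ)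
        (pr q) (φ q)) q₀ := by
  rw [contMDiffAt_totalSpace]
  refine ⟨hpr, ?_⟩
  -- `A` is the derivative of `f` in the trivialization at `pr q₀`. In that trivialization the
  -- pulled back form is `B` with `A` inserted in both slots, hence a composition of smooth families
  -- of operators.
  set A : F → EuclideanSpace ℝ (Fin k) →L[ℝ] V :=
    inTangentCoordinates (𝓡 k) 𝓘(ℝ, V) id f (mfderiv (𝓡 k) 𝓘(ℝ, V) f) (pr q₀) with hA
  have hAs : ContMDiffAt IN 𝓘(ℝ, EuclideanSpace ℝ (Fin k) →L[ℝ] V) ∞ (fun q ↦ A (pr q)) q₀ :=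
    ContMDiffAt.comp q₀ ((hf (pr q₀)).mfderiv_const (m := ∞) (by simp)) hpr
  have hC : ContMDiffAt IN 𝓘(ℝ, (V →L[ℝ] ℝ) →L[ℝ] (EuclideanSpace ℝ (Fin k) →L[ℝ] ℝ)) ∞
      (fun q ↦ (ContinuousLinearMap.compL ℝ (EuclideanSpace ℝ (Fin k)) V ℝ).flip (A (pr q))) q₀ :=
    ContMDiffAt.clm_apply contMDiffAt_const hAs
  refine (hC.clm_comp (hB.clm_comp hAs)).congr_of_eventuallyEq ?_
  have hbase := hpr.continuousAt.eventually ((trivializationAt (EuclideanSpace ℝ (Fin k))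
    (TangentSpace (𝓡 k)) (pr q₀)).open_baseSet.mem_nhds (mem_baseSet_trivializationAt _ _ _))
  filter_upwards [hbase, hφ] with q hq hφq
  ext1 a
  ext1 b
  refine (trivializationAt_bilin_apply hq (φ q) a b).trans ?_
  have hAa : ∀ a, A (pr q) a = mvfderiv (𝓡 k) f (pr q)
      ((trivializationAt (EuclideanSpace ℝ (Fin k)) (TangentSpace (𝓡 k)) (pr q₀)).symmL ℝ (pr q) a) := by
    intro a
    simp [hA, inTangentCoordinates, ContinuousLinearMap.inCoordinates]
    rfl
  rw [hφq]
  simp only [ContinuousLinearMap.comp_apply, ContinuousLinearMap.flip_apply,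
    ContinuousLinearMap.compL_apply, hAa]

end BilinearForms

/-! ### Polar coordinates in an inner product space -/

section PolarCoordinates

variable {V : Type*} [NormedAddCommGroup V] [InnerProductSpace ℝ V] {n : ℕ}
  [Fact (Module.finrank ℝ V = n + 1)]

/-- The tangent space of the sphere at `x` is the orthogonal complement of `x`. With the Gauss
lemma, this removes the mixed terms of the polar metric. -/
theorem inner_mvfderiv_coe_sphere (x : sphere (0 : V) 1) (u : TangentSpace (𝓡 n) x) :
    inner ℝ (x : V) (mvfderiv (𝓡 n) ((↑) : sphere (0 : V) 1 → V) x u) = 0 := by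
  have h : mvfderiv (𝓡 n) ((↑) : sphere (0 : V) 1 → V) x u ∈ (ℝ ∙ (x : V))ᗮ := by
    rw [← range_mvfderiv_subtypeVal (n := n) x]
    exact LinearMap.mem_range_self _ u
  exact Submodule.mem_orthogonal_singleton_iff_inner_right.1 h

theorem contMDiff_smul_coe_sphere :
    ContMDiff (𝓘(ℝ, ℝ).prod (𝓡 n)) 𝓘(ℝ, V) ∞
      (fun q : ℝ × sphere (0 : V) 1 ↦ q.1 • (q.2 : V)) :=
  contMDiff_fst.smul (contMDiff_coe_sphere.comp contMDiff_snd)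

/-- The derivative of the polar coordinates `(t, x) ↦ t x` of a vector space. -/
theorem mvfderiv_smul_coe_sphere (t : ℝ) (x : sphere (0 : V) 1) (a : ℝ)
    (u : TangentSpace (𝓡 n) x) :
    mvfderiv (𝓘(ℝ, ℝ).prod (𝓡 n)) (fun q : ℝ × sphere (0 : V) 1 ↦ q.1 • (q.2 : V)) (t, x) (a, u)
      = a • (x : V) + t • mvfderiv (𝓡 n) ((↑) : sphere (0 : V) 1 → V) x u := by
  have h1 : MDifferentiableAt (𝓘(ℝ, ℝ).prod (𝓡 n)) 𝓘(ℝ, ℝ)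
      (fun q : ℝ × sphere (0 : V) 1 ↦ q.1) (t, x) := mdifferentiableAt_fst
  have hc : MDifferentiableAt (𝓡 n) 𝓘(ℝ, V) ((↑) : sphere (0 : V) 1 → V) x :=
    contMDiff_coe_sphere.mdifferentiableAt (n := 1) one_ne_zero
  have h2 : MDifferentiableAt (𝓘(ℝ, ℝ).prod (𝓡 n)) 𝓘(ℝ, V)
      (fun q : ℝ × sphere (0 : V) 1 ↦ (q.2 : V)) (t, x) :=
    MDifferentiableAt.comp (t, x) hc mdifferentiableAt_snd
  have e1 : mvfderiv (𝓘(ℝ, ℝ).prod (𝓡 n)) (fun q : ℝ × sphere (0 : V) 1 ↦ q.1) (t, x) (a, u)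
      = a := by
    have := mfderiv_fst (I := 𝓘(ℝ, ℝ)) (I' := 𝓡 n) (x := (t, x))
    exact congrArg (fun T ↦ T (a, u)) this
  have e2 : mvfderiv (𝓘(ℝ, ℝ).prod (𝓡 n)) (fun q : ℝ × sphere (0 : V) 1 ↦ (q.2 : V)) (t, x) (a, u)
      = mvfderiv (𝓡 n) ((↑) : sphere (0 : V) 1 → V) x u := by
    have h := mfderiv_comp (t, x) (I := 𝓘(ℝ, ℝ).prod (𝓡 n))
      (f := (Prod.snd : ℝ × sphere (0 : V) 1 → sphere (0 : V) 1)) hc mdifferentiableAt_snd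
    rw [mfderiv_snd] at h
    exact congrArg (fun T ↦ T (a, u)) h
  have h3 := congrArg (fun T ↦ T (a, u)) (mvfderiv_fun_smul h1 h2)
  refine h3.trans ?_
  change t • mvfderiv (𝓘(ℝ, ℝ).prod (𝓡 n)) (fun q : ℝ × sphere (0 : V) 1 ↦ (q.2 : V)) (t, x) (a, u)
    + mvfderiv (𝓘(ℝ, ℝ).prod (𝓡 n)) (fun q : ℝ × sphere (0 : V) 1 ↦ q.1) (t, x) (a, u) • (x : V) = _
  rw [e1, e2, add_comm]

/-- Provides the angular part of the inverse of polar coordinates. The value at the origin is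
arbitrary; the smooth corestriction to the sphere is taken on the punctured space, regarded as an
open submanifold. -/
theorem exists_contMDiffOn_normalize_sphere :
    ∃ f : V → sphere (0 : V) 1, ContMDiffOn 𝓘(ℝ, V) (𝓡 n) ∞ f {0}ᶜ ∧
      ∀ y ≠ 0, (f y : V) = ‖y‖⁻¹ • y := by
  classical
  have : Nontrivial V :=
    Module.nontrivial_of_finrank_pos (R := ℝ) (by rw [Fact.out (p := Module.finrank ℝ V = n + 1)]; lia)
  obtain ⟨d⟩ : Nonempty (sphere (0 : V) 1) := (NormedSpace.sphere_nonempty.2 zero_le_one).to_subtype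
  let U : TopologicalSpace.Opens V := ⟨{0}ᶜ, isOpen_compl_singleton⟩
  have hn (y : V) (hy : y ≠ 0) : ‖y‖⁻¹ • y ∈ sphere (0 : V) 1 := by
    simp [norm_smul, hy]
  let f : V → sphere (0 : V) 1 := fun y ↦ if hy : y = 0 then d else ⟨‖y‖⁻¹ • y, hn y hy⟩
  have hf (y : V) (hy : y ≠ 0) : (f y : V) = ‖y‖⁻¹ • y := by simp [f, hy]
  refine ⟨f, fun y hy ↦ ContMDiffAt.contMDiffWithinAt ?_, hf⟩
  refine (contMDiffAt_subtype_iff (U := U) (x := ⟨y, hy⟩)).1 ?_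
  have hs : ContMDiff 𝓘(ℝ, V) 𝓘(ℝ, V) ∞ (fun y : U ↦ ‖(y : V)‖⁻¹ • (y : V)) := by
    intro z
    refine (contMDiffAt_subtype_iff (U := U) (x := z) (f := fun y : V ↦ ‖y‖⁻¹ • y)).2 ?_
    have hz : (z : V) ≠ 0 := z.2
    exact (((contDiffAt_norm ℝ hz).inv (norm_ne_zero_iff.2 hz)).smul contDiffAt_id).contMDiffAt
  have := (hs.codRestrict_sphere (n := n) (fun z ↦ hn z z.2)) ⟨y, hy⟩
  refine this.congr_of_eventuallyEq (Eventually.of_forall fun z ↦ ?_)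
  have hz : (z : V) ≠ 0 := z.2
  exact Subtype.ext (by simp [hf z hz])

/-- Polar coordinates on the punctured ball of radius `ε` of a vector space. -/
theorem exists_polar_partialDiffeomorph (ε : ℝ) :
    ∃ e : PartialDiffeomorph (𝓘(ℝ, ℝ).prod (𝓡 n)) 𝓘(ℝ, V) (ℝ × sphere (0 : V) 1) V ∞,
      e.source = Ioo 0 ε ×ˢ univ ∧ e.target = ball 0 ε \ {0} ∧
      ∀ q, e q = q.1 • (q.2 : V) := by
  obtain ⟨f, hf, hfv⟩ := exists_contMDiffOn_normalize_sphere (V := V) (n := n)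
  have hx (x : sphere (0 : V) 1) : ‖(x : V)‖ = 1 := norm_eq_of_mem_sphere x
  have h0 (q : ℝ × sphere (0 : V) 1) (hq : 0 < q.1) : q.1 • (q.2 : V) ≠ 0 :=
    smul_ne_zero hq.ne' (norm_ne_zero_iff.1 (by simp [hx]))
  refine ⟨
    { toFun := fun q ↦ q.1 • (q.2 : V)
      invFun := fun y ↦ (‖y‖, f y)
      source := Ioo 0 ε ×ˢ univ
      target := ball 0 ε \ {0}
      map_source' := ?_
      map_target' := ?_
      left_inv' := ?_
      right_inv' := ?_
      open_source := isOpen_Ioo.prod isOpen_univ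
      open_target := isOpen_ball.sdiff isClosed_singleton
      contMDiffOn_toFun := contMDiff_smul_coe_sphere.contMDiffOn
      contMDiffOn_invFun := ?_ }, rfl, rfl, fun q ↦ rfl⟩
  · rintro q ⟨⟨hq, hq'⟩, -⟩
    exact ⟨by simpa [norm_smul, hx, abs_of_pos hq] using hq', h0 q hq⟩
  · rintro y ⟨hy, hy0⟩
    exact ⟨⟨norm_pos_iff.2 hy0, mem_ball_zero_iff.1 hy⟩, mem_univ _⟩
  · rintro q ⟨⟨hq, hq'⟩, -⟩
    have hn : ‖q.1 • (q.2 : V)‖ = q.1 := by simp [norm_smul, hx, abs_of_pos hq]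
    refine Prod.ext hn (Subtype.ext ?_)
    dsimp only
    rw [hfv _ (h0 q hq), hn, smul_smul, inv_mul_cancel₀ hq.ne', one_smul]
  · rintro y ⟨hy, hy0⟩
    have : ‖y‖ ≠ 0 := norm_ne_zero_iff.2 hy0
    simp [hfv y hy0, smul_smul, this]
  · refine ContMDiffOn.prodMk (fun y hy ↦ ?_) (hf.mono fun y hy ↦ hy.2)
    exact ((contDiffAt_norm ℝ hy.2).contMDiffAt).contMDiffWithinAt

end PolarCoordinates

/-! ### The geodesic equation on an open subset of a vector space -/

section GeodesicEquation

variable {E : Type*} [NormedAddCommGroup E] [NormedSpace ℝ E]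

/-- The left-hand side `g(u, w) + Γ(v, v; w)` of the geodesic equation of the metric `G` for a curve
through `y` with velocity `v` and second derivative `u`. -/
noncomputable def geodesicForm (G : E → E →L[ℝ] E →L[ℝ] ℝ) (y v u w : E) : ℝ :=
  G y u w + (fderiv ℝ G y v v w - fderiv ℝ G y w v v / 2)

theorem bilin_isInvertible [FiniteDimensional ℝ E] {B : E →L[ℝ] E →L[ℝ] ℝ}
    (hB : ∀ a ≠ 0, 0 < B a a) : B.IsInvertible := by
  have hinj : Function.Injective (B : E →ₗ[ℝ] E →L[ℝ] ℝ) := by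
    refine (injective_iff_map_eq_zero _).2 fun a ha ↦ ?_
    by_contra h
    exact (hB a h).ne' (congrArg (fun T : E →L[ℝ] ℝ ↦ T a) ha)
  have hdim : Module.finrank ℝ E = Module.finrank ℝ (E →L[ℝ] ℝ) := by
    rw [← LinearEquiv.finrank_eq (LinearMap.toContinuousLinearMap (𝕜 := ℝ) (E := E) (F' := ℝ))]
    exact (Subspace.dual_finrank_eq (K := ℝ) (V := E)).symm
  let e := LinearEquiv.ofInjectiveOfFinrankEq (B : E →ₗ[ℝ] E →L[ℝ] ℝ) hinj hdim
  exact ⟨e.toContinuousLinearEquiv, by ext; rfl⟩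

/-- The geodesic spray of a metric on an open subset of a vector space. -/
theorem exists_geodesicSpray [FiniteDimensional ℝ E] {G : E → E →L[ℝ] E →L[ℝ] ℝ} {Ω : Set E}
    (hΩ : IsOpen Ω) (hG : ContDiffOn ℝ ∞ G Ω) (hpos : ∀ y ∈ Ω, ∀ a ≠ 0, 0 < G y a a) :
    ∃ S : E × E → E, ContDiffOn ℝ ∞ S (Ω ×ˢ univ) ∧
      (∀ (y v : E) (t : ℝ), S (y, t • v) = t ^ 2 • S (y, v)) ∧
      ∀ y ∈ Ω, ∀ v u, (∀ w, geodesicForm G y v u w = 0) ↔ u = S (y, v) := by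
  have : CompleteSpace E := FiniteDimensional.complete ℝ E
  -- `R (y, v)` is the functional `-Γ(v, v; ·)`, so the geodesic equation says `G y u = R (y, v)`.
  -- It is solved by inverting `G y`, which positivity makes invertible.
  set R : E × E → E →L[ℝ] ℝ := fun q ↦
    (2 : ℝ)⁻¹ • ((fderiv ℝ G q.1).flip q.2).flip q.2 - fderiv ℝ G q.1 q.2 q.2 with hR
  have hRa (y v w : E) : R (y, v) w = fderiv ℝ G y w v v / 2 - fderiv ℝ G y v v w := by
    simp [hR]; ring
  have hG1 : ContDiffOn ℝ ∞ (fun q : E × E ↦ G q.1) (Ω ×ˢ univ) :=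
    hG.comp contDiff_fst.contDiffOn fun q hq ↦ hq.1
  have hG2 : ContDiffOn ℝ ∞ (fun q : E × E ↦ fderiv ℝ G q.1) (Ω ×ˢ univ) :=
    (hG.fderiv_of_isOpen hΩ (m := ∞) (by simp)).comp contDiff_fst.contDiffOn fun q hq ↦ hq.1
  have hRs : ContDiffOn ℝ ∞ R (Ω ×ˢ univ) := by
    refine contDiffOn_clm_apply.2 fun w ↦ ?_
    have h1 := ((hG2.clm_apply (contDiffOn_const (c := w))).clm_apply
      contDiff_snd.contDiffOn).clm_apply contDiff_snd.contDiffOn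
    have h2 := ((hG2.clm_apply contDiff_snd.contDiffOn).clm_apply
      contDiff_snd.contDiffOn).clm_apply (contDiffOn_const (c := w))
    exact ((h1.div_const 2).sub h2).congr fun q _ ↦ hRa q.1 q.2 w
  refine ⟨fun q ↦ (G q.1).inverse (R q), ?_, ?_, ?_⟩
  · refine ContDiffOn.clm_apply ?_ hRs
    intro q hq
    obtain ⟨e, he⟩ := bilin_isInvertible (hpos q.1 hq.1)
    have := contDiffAt_map_inverse (n := ∞) e
    rw [he] at this
    exact this.comp_contDiffWithinAt q (hG1 q hq)
  · intro y v t
    have : R (y, t • v) = t ^ 2 • R (y, v) := by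
      ext w
      simp only [hRa, map_smul, smul_apply, smul_eq_mul]
      ring
    simp [this]
  · intro y hy v u
    obtain ⟨e, he⟩ := bilin_isInvertible (hpos y hy)
    have h1 : (∀ w, geodesicForm G y v u w = 0) ↔ e u = R (y, v) := by
      rw [ContinuousLinearMap.ext_iff]
      refine forall_congr' fun w ↦ ?_
      have : (e u : E →L[ℝ] ℝ) = G y u := congrArg (fun T : E →L[ℝ] E →L[ℝ] ℝ ↦ T u) he
      rw [this, hRa, geodesicForm]
      constructor <;> intro h <;> linarith
    rw [h1]
    dsimp only
    rw [← he, ContinuousLinearMap.inverse_equiv, ContinuousLinearEquiv.coe_coe,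
      ContinuousLinearEquiv.eq_symm_apply]

/-- The exponential map at `y₀` of a metric on an open subset of a vector space. -/
theorem exists_isRadialGeodesicMap [FiniteDimensional ℝ E] {G : E → E →L[ℝ] E →L[ℝ] ℝ}
    {Ω : Set E} (hΩ : IsOpen Ω) (hG : ContDiffOn ℝ ∞ G Ω) (hpos : ∀ y ∈ Ω, ∀ a ≠ 0, 0 < G y a a)
    (hsymm : ∀ y a b, G y a b = G y b a) {y₀ : E} (hy₀ : y₀ ∈ Ω) :
    ∃ r > 0, ∃ 𝓔 : E → E, 𝓔 0 = y₀ ∧ IsRadialGeodesicMap G 𝓔 r ∧ ∀ x ∈ ball 0 r, 𝓔 x ∈ Ω := by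
  have : CompleteSpace E := FiniteDimensional.complete ℝ E
  obtain ⟨S, hS, hquad, hS'⟩ := exists_geodesicSpray hΩ hG hpos
  -- The cutoff makes the spray smooth on the whole space. It depends on the position only, so the
  -- equation remains quadratic in the velocity, and near `y₀` it is unchanged.
  obtain ⟨χ, hχ0, hχ1, hχs, -⟩ : ∃ χ : E → ℝ, tsupport χ ⊆ Ω ∧ (∀ᶠ y in 𝓝 y₀, χ y = 1) ∧
      ContDiff ℝ ∞ χ ∧ True := by
    obtain ⟨ρ, hρ, hb⟩ := nhds_basis_closedBall.mem_iff.1 (hΩ.mem_nhds hy₀)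
    let χ : ContDiffBump y₀ := ⟨ρ / 2, ρ, by positivity, by linarith⟩
    exact ⟨χ, by rw [χ.tsupport_eq]; exact hb, χ.eventuallyEq_one, χ.contDiff, trivial⟩
  have hf : ContDiff ℝ ∞ fun q : E × E ↦ χ q.1 • S q := by
    rw [contDiff_iff_contDiffAt]
    intro q
    by_cases hq : q.1 ∈ Ω
    · exact (hχs.contDiffAt.comp q contDiffAt_fst).smul
        (hS.contDiffAt ((hΩ.prod isOpen_univ).mem_nhds ⟨hq, mem_univ _⟩))
    · have h0 : χ =ᶠ[𝓝 q.1] 0 := notMem_tsupport_iff_eventuallyEq.1 fun h ↦ hq (hχ0 h)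
      refine contDiffAt_const (c := (0 : E)) |>.congr_of_eventuallyEq ?_
      filter_upwards [continuous_fst.continuousAt.eventually h0] with z hz
      simp [hz]
  obtain ⟨r, hr, 𝓔, h0, hsm, hd, hgeo⟩ := exists_radial_solution hf
    (fun y v t ↦ by dsimp only; rw [hquad, smul_comm]) y₀
  have hev : ∀ᶠ x in 𝓝 (0 : E), χ (𝓔 x) = 1 ∧ 𝓔 x ∈ Ω := by
    have := hd.continuousAt.tendsto
    rw [h0] at this
    exact this.eventually (hχ1.and (hΩ.mem_nhds hy₀))
  obtain ⟨ρ, hρ, hb⟩ := Metric.eventually_nhds_iff_ball.1 hev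
  have hsub : ball (0 : E) (min r ρ) ⊆ ball 0 r := ball_subset_ball (min_le_left _ _)
  have hsub' : ball (0 : E) (min r ρ) ⊆ ball 0 ρ := ball_subset_ball (min_le_right _ _)
  refine ⟨min r ρ, lt_min hr hρ, 𝓔, h0, ⟨hsymm, hsm.mono hsub, hd, fun x hx ↦ ?_, ?_⟩,
    fun x hx ↦ (hb x (hsub' hx)).2⟩
  · exact (hG.contDiffAt (hΩ.mem_nhds (hb x (hsub' hx)).2)).differentiableAt (by simp)
  · intro v t hvt w
    refine (hS' _ (hb _ (hsub' hvt)).2 _ _).2 ?_ w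
    rw [hgeo v t (hsub hvt), (hb _ (hsub' hvt)).1, one_smul]

theorem ContDiffAt.deriv_infty {c : ℝ → E} {t : ℝ} (hc : ContDiffAt ℝ ∞ c t) :
    ContDiffAt ℝ ∞ (deriv c) t := by
  have : deriv c = fun s ↦ fderiv ℝ c s 1 := funext fun s ↦ (fderiv_apply_one_eq_deriv).symm
  rw [this]
  exact (hc.fderiv_right (m := ∞) (by simp)).clm_apply contDiffAt_const

/-- A geodesic is determined by its position and velocity at one time. -/
theorem eventuallyEq_of_geodesic [FiniteDimensional ℝ E] {G : E → E →L[ℝ] E →L[ℝ] ℝ}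
    {Ω : Set E} (hΩ : IsOpen Ω) (hG : ContDiffOn ℝ ∞ G Ω) (hpos : ∀ y ∈ Ω, ∀ a ≠ 0, 0 < G y a a)
    {c₁ c₂ : ℝ → E} {t : ℝ} (h₁ : ∀ᶠ s in 𝓝 t, ContDiffAt ℝ ∞ c₁ s)
    (h₂ : ∀ᶠ s in 𝓝 t, ContDiffAt ℝ ∞ c₂ s)
    (heq : c₁ t = c₂ t) (hd : deriv c₁ t = deriv c₂ t) (hΩt : c₁ t ∈ Ω)
    (hg₁ : ∀ᶠ s in 𝓝 t, ∀ w, geodesicForm G (c₁ s) (deriv c₁ s) (deriv (deriv c₁) s) w = 0)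
    (hg₂ : ∀ᶠ s in 𝓝 t, ∀ w, geodesicForm G (c₂ s) (deriv c₂ s) (deriv (deriv c₂) s) w = 0) :
    c₁ =ᶠ[𝓝 t] c₂ := by
  obtain ⟨S, hS, -, hS'⟩ := exists_geodesicSpray hΩ hG hpos
  -- The pair `(c, c')` solves a first order system whose field is locally Lipschitz, so uniqueness
  -- for such systems applies.
  have hSt : ContDiffAt ℝ 1 (fun q : E × E ↦ (q.2, S q)) (c₁ t, deriv c₁ t) :=
    contDiffAt_snd.prodMk ((hS.contDiffAt ((hΩ.prod isOpen_univ).mem_nhds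
      ⟨hΩt, mem_univ _⟩)).of_le (by simp))
  obtain ⟨K, s, hs, hK⟩ := hSt.exists_lipschitzOnWith
  have key : ∀ c : ℝ → E, (∀ᶠ s in 𝓝 t, ContDiffAt ℝ ∞ c s) → c t = c₁ t → deriv c t = deriv c₁ t →
      (∀ᶠ s in 𝓝 t, ∀ w, geodesicForm G (c s) (deriv c s) (deriv (deriv c) s) w = 0) →
      ∀ᶠ z in 𝓝 t, HasDerivAt (fun z ↦ (c z, deriv c z)) (deriv c z, S (c z, deriv c z)) z ∧
        (c z, deriv c z) ∈ s := by
    intro c hc h0 h1 hg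
    have hc' := hc.self_of_nhds
    have hcont : ContinuousAt (fun z ↦ (c z, deriv c z)) t :=
      hc'.continuousAt.prodMk hc'.deriv_infty.continuousAt
    have hmem : ∀ᶠ z in 𝓝 t, (c z, deriv c z) ∈ s := hcont (by dsimp only; rw [h0, h1]; exact hs)
    have hΩc : ∀ᶠ z in 𝓝 t, c z ∈ Ω := hc'.continuousAt (hΩ.mem_nhds (by rwa [h0]))
    filter_upwards [hmem, hΩc, hg, hc] with z h2 h3 h4 h5
    refine ⟨?_, h2⟩
    rw [← (hS' _ h3 _ _).1 h4]
    exact (h5.differentiableAt (by simp)).hasDerivAt.prodMk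
      (h5.deriv_infty.differentiableAt (by simp)).hasDerivAt
  have := ODE_solution_unique_of_eventually (v := fun _ q ↦ (q.2, S q)) (s := fun _ ↦ s) (K := K)
    (Eventually.of_forall fun _ ↦ hK) (key c₁ h₁ rfl rfl hg₁) (key c₂ h₂ heq.symm hd.symm hg₂)
    (by simp [heq, hd])
  filter_upwards [this] with z hz using congrArg Prod.fst hz

/-- The geodesic equation is invariant under changes of coordinates. -/
theorem geodesicForm_pullback {G G₁ : E → E →L[ℝ] E →L[ℝ] ℝ} {τ : E → E} {y : E}
    (hsymm : ∀ y a b, G y a b = G y b a) 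
    (hG : DifferentiableAt ℝ G (τ y)) (hG₁ : DifferentiableAt ℝ G₁ y) (hτ : ContDiffAt ℝ ∞ τ y)
    (h : ∀ᶠ z in 𝓝 y, ∀ a b, G₁ z a b = G (τ z) (fderiv ℝ τ z a) (fderiv ℝ τ z b)) (v u w : E) :
    geodesicForm G₁ y v u w = geodesicForm G (τ y) (fderiv ℝ τ y v)
      (fderiv ℝ (fderiv ℝ τ) y v v + fderiv ℝ τ y u) (fderiv ℝ τ y w) := by
  have hτ1 : HasFDerivAt τ (fderiv ℝ τ y) y := (hτ.differentiableAt (by simp)).hasFDerivAt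
  have hτ2 : HasFDerivAt (fderiv ℝ τ) (fderiv ℝ (fderiv ℝ τ) y) y :=
    ((hτ.fderiv_right (m := ∞) (by simp)).differentiableAt (by simp)).hasFDerivAt
  have hsym2 : ∀ a b, fderiv ℝ (fderiv ℝ τ) y a b = fderiv ℝ (fderiv ℝ τ) y b a :=
    (hτ.isSymmSndFDerivAt (by
      rw [minSmoothness_of_isRCLikeNormedField]; exact ENat.LEInfty.out)).eq
  have key : ∀ c a b, fderiv ℝ G₁ y c a b
      = fderiv ℝ G (τ y) (fderiv ℝ τ y c) (fderiv ℝ τ y a) (fderiv ℝ τ y b)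
        + G (τ y) (fderiv ℝ (fderiv ℝ τ) y c a) (fderiv ℝ τ y b)
        + G (τ y) (fderiv ℝ τ y a) (fderiv ℝ (fderiv ℝ τ) y c b) := by
    intro c a b
    have hl : HasDerivAt (fun s : ℝ ↦ y + s • c) c 0 := by
      simpa using ((hasDerivAt_id (0 : ℝ)).smul_const c).const_add y
    have hl0 : y + (0 : ℝ) • c = y := by simp
    have e1 : HasDerivAt (fun s : ℝ ↦ G₁ (y + s • c) a b) (fderiv ℝ G₁ y c a b) 0 := by
      have h1 := HasDerivAt.bilin_apply (c := fun s : ℝ ↦ y + s • c) (t := 0)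
        (G := G₁) (G' := fderiv ℝ G₁ y) (by rw [hl0]; exact hG₁.hasFDerivAt) hl
        (hasDerivAt_const (0 : ℝ) a) (hasDerivAt_const (0 : ℝ) b)
      simpa using h1
    have e2 : HasDerivAt (fun s : ℝ ↦ G (τ (y + s • c)) (fderiv ℝ τ (y + s • c) a)
        (fderiv ℝ τ (y + s • c) b)) (fderiv ℝ G (τ y) (fderiv ℝ τ y c) (fderiv ℝ τ y a)
          (fderiv ℝ τ y b) + G (τ y) (fderiv ℝ (fderiv ℝ τ) y c a) (fderiv ℝ τ y b)
        + G (τ y) (fderiv ℝ τ y a) (fderiv ℝ (fderiv ℝ τ) y c b)) 0 := by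
      have ht : HasDerivAt (fun s : ℝ ↦ τ (y + s • c)) (fderiv ℝ τ y c) 0 :=
        HasFDerivAt.comp_hasDerivAt (0 : ℝ) (by rw [hl0]; exact hτ1) hl
      have ha : ∀ a, HasDerivAt (fun s : ℝ ↦ fderiv ℝ τ (y + s • c) a)
          (fderiv ℝ (fderiv ℝ τ) y c a) 0 := fun a ↦ by
        have := HasFDerivAt.hasDerivAt_apply (c := fun s : ℝ ↦ y + s • c) (t := 0)
          (T := fderiv ℝ τ) (T' := fderiv ℝ (fderiv ℝ τ) y) (by rw [hl0]; exact hτ2) hl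
          (hasDerivAt_const (0 : ℝ) a)
        simpa using this
      have := HasDerivAt.bilin_apply (c := fun s : ℝ ↦ τ (y + s • c)) (t := 0)
        (G := G) (G' := fderiv ℝ G (τ y)) (by rw [hl0]; exact hG.hasFDerivAt) ht (ha a) (ha b)
      simpa only [hl0] using this
    refine e1.unique (e2.congr_of_eventuallyEq ?_)
    have : Tendsto (fun s : ℝ ↦ y + s • c) (𝓝 0) (𝓝 y) := by
      simpa [hl0] using hl.continuousAt.tendsto
    filter_upwards [this.eventually h] with s hs using hs a b
  have h0 := h.self_of_nhds
  -- Of the terms with second derivatives of `τ`, those containing `D²τ(v, w)` cancel by symmetry;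
  -- what remains is `G(D²τ(v, v), Dτ w)`, the correction to the acceleration.
  simp only [geodesicForm, key, h0, map_add, add_apply, hsym2 w v]
  rw [hsymm (τ y) (fderiv ℝ (fderiv ℝ τ) y v w)]
  ring

end GeodesicEquation

/-! ### The metric in charts -/

section ChartMetric

set_option linter.unusedSectionVars false

variable {m : ℕ} {M : Type*} [TopologicalSpace M] [ChartedSpace (EuclideanSpace ℝ (Fin m)) M]
  [IsManifold (𝓡 m) ∞ M] [RiemannianBundle (fun x : M ↦ TangentSpace (𝓡 m) x)]

local notation "𝔼" => EuclideanSpace ℝ (Fin m)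

/-- The metric in the chart at `x₀` as a continuous bilinear form. -/
noncomputable def chartMetricCLM (x₀ : M) (y : 𝔼) : 𝔼 →L[ℝ] 𝔼 →L[ℝ] ℝ :=
  (innerSL ℝ (E := TangentSpace (𝓡 m) ((extChartAt (𝓡 m) x₀).symm y))).bilinearComp
    (mfderiv 𝓘(ℝ, 𝔼) (𝓡 m) (extChartAt (𝓡 m) x₀).symm y)
    (mfderiv 𝓘(ℝ, 𝔼) (𝓡 m) (extChartAt (𝓡 m) x₀).symm y)

theorem chartMetricCLM_apply (x₀ : M) (y a b : 𝔼) :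
    chartMetricCLM x₀ y a b = chartMetric x₀ y a b := rfl

theorem chartMetricCLM_symm (x₀ : M) (y a b : 𝔼) :
    chartMetricCLM x₀ y a b = chartMetricCLM x₀ y b a :=
  real_inner_comm (F := TangentSpace (𝓡 m) ((extChartAt (𝓡 m) x₀).symm y)) _ _

theorem contMDiffAt_extChartAt_symm_of_mem {x₀ : M} {y : 𝔼}
    (hy : y ∈ (extChartAt (𝓡 m) x₀).target) :
    ContMDiffAt 𝓘(ℝ, 𝔼) (𝓡 m) ∞ (extChartAt (𝓡 m) x₀).symm y :=
  (contMDiffOn_extChartAt_symm x₀).contMDiffAt ((isOpen_extChartAt_target x₀).mem_nhds hy)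

theorem mdifferentiableAt_extChartAt_symm_of_mem {x₀ : M} {y : 𝔼}
    (hy : y ∈ (extChartAt (𝓡 m) x₀).target) :
    MDifferentiableAt 𝓘(ℝ, 𝔼) (𝓡 m) (extChartAt (𝓡 m) x₀).symm y :=
  (contMDiffAt_extChartAt_symm_of_mem hy).mdifferentiableAt (by simp)

theorem injective_mfderiv_extChartAt_symm {x₀ : M} {y : 𝔼}
    (hy : y ∈ (extChartAt (𝓡 m) x₀).target) :
    Function.Injective (mfderiv 𝓘(ℝ, 𝔼) (𝓡 m) (extChartAt (𝓡 m) x₀).symm y) := by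
  have h := mfderiv_extChartAt_comp_mfderivWithin_extChartAt_symm (I := 𝓡 m) hy
  rw [ModelWithCorners.range_eq_univ, mfderivWithin_univ] at h
  intro a b hab
  have ha := congrArg (fun T : TangentSpace 𝓘(ℝ, 𝔼) y →L[ℝ] 𝔼 ↦ T a) h
  have hb := congrArg (fun T : TangentSpace 𝓘(ℝ, 𝔼) y →L[ℝ] 𝔼 ↦ T b) h
  have ha' : mfderiv (𝓡 m) 𝓘(ℝ, 𝔼) (extChartAt (𝓡 m) x₀) ((extChartAt (𝓡 m) x₀).symm y)
    (mfderiv 𝓘(ℝ, 𝔼) (𝓡 m) (extChartAt (𝓡 m) x₀).symm y a) = a := ha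
  have hb' : mfderiv (𝓡 m) 𝓘(ℝ, 𝔼) (extChartAt (𝓡 m) x₀) ((extChartAt (𝓡 m) x₀).symm y)
    (mfderiv 𝓘(ℝ, 𝔼) (𝓡 m) (extChartAt (𝓡 m) x₀).symm y b) = b := hb
  rw [← ha', ← hb', hab]

theorem chartMetricCLM_pos {x₀ : M} {y : 𝔼} (hy : y ∈ (extChartAt (𝓡 m) x₀).target) {a : 𝔼}
    (ha : a ≠ 0) : 0 < chartMetricCLM x₀ y a a := by
  refine (real_inner_self_pos (F := TangentSpace (𝓡 m) ((extChartAt (𝓡 m) x₀).symm y))).2 fun h ↦ ha ?_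
  exact injective_mfderiv_extChartAt_symm hy (h.trans (map_zero _).symm)

theorem contMDiffOn_mfderiv_extChartAt_symm (x₀ : M) (a : 𝔼) :
    ContMDiffOn 𝓘(ℝ, 𝔼) (𝓡 m).tangent ∞ (fun y : 𝔼 ↦
      (⟨(extChartAt (𝓡 m) x₀).symm y, mfderiv 𝓘(ℝ, 𝔼) (𝓡 m) (extChartAt (𝓡 m) x₀).symm y a⟩ :
        TangentBundle (𝓡 m) M)) (extChartAt (𝓡 m) x₀).target := by
  have ho := isOpen_extChartAt_target (I := 𝓡 m) x₀
  have h := (contMDiffOn_extChartAt_symm (I := 𝓡 m) (n := ∞) x₀).contMDiffOn_tangentMapWithin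
    (m := ∞) (by simp) ho.uniqueMDiffOn
  have hs : ContMDiffOn 𝓘(ℝ, 𝔼) 𝓘(ℝ, 𝔼).tangent ∞
      (fun y : 𝔼 ↦ (⟨y, a⟩ : TangentBundle 𝓘(ℝ, 𝔼) 𝔼)) (extChartAt (𝓡 m) x₀).target :=
    fun y _ ↦ contMDiffWithinAt_vectorSpace_iff_contDiffWithinAt.2 contDiffWithinAt_const
  refine (h.comp hs fun y hy ↦ hy).congr fun y hy ↦ ?_
  simp only [Function.comp_apply, tangentMapWithin]
  rw [mfderivWithin_of_isOpen ho hy]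

/-- In finite dimension it suffices to test on fixed vectors `a`, `b`; each entry is the inner
product of two smooth vector fields along the inverse chart. -/
theorem contDiffOn_chartMetricCLM [IsContMDiffRiemannianBundle (𝓡 m) ∞ 𝔼
    (fun x : M ↦ TangentSpace (𝓡 m) x)] (x₀ : M) :
    ContDiffOn ℝ ∞ (chartMetricCLM x₀) (extChartAt (𝓡 m) x₀).target := by
  refine contDiffOn_clm_apply.2 fun a ↦ contDiffOn_clm_apply.2 fun b ↦ ?_
  exact ((contMDiffOn_mfderiv_extChartAt_symm x₀ a).inner_bundle
    (contMDiffOn_mfderiv_extChartAt_symm x₀ b)).contDiffOn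

theorem fderiv_chartMetric [IsContMDiffRiemannianBundle (𝓡 m) ∞ 𝔼
    (fun x : M ↦ TangentSpace (𝓡 m) x)] {x₀ : M} {y : 𝔼}
    (hy : y ∈ (extChartAt (𝓡 m) x₀).target) (a b w : 𝔼) :
    fderiv ℝ (fun z ↦ chartMetric x₀ z a b) y w = fderiv ℝ (chartMetricCLM x₀) y w a b := by
  have h : HasFDerivAt (chartMetricCLM x₀) (fderiv ℝ (chartMetricCLM x₀) y) y :=
    (((contDiffOn_chartMetricCLM x₀).contDiffAt ((isOpen_extChartAt_target x₀).mem_nhds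
      hy)).differentiableAt (by simp)).hasFDerivAt
  have h2 := ((ContinuousLinearMap.apply ℝ ℝ b ∘L
      ContinuousLinearMap.apply ℝ (𝔼 →L[ℝ] ℝ) a).hasFDerivAt.comp y h).fderiv
  exact congrArg (fun T : 𝔼 →L[ℝ] ℝ ↦ T w) h2

/-- With equal velocity arguments the first two terms of the Christoffel symbol coincide, which
absorbs the factor `1/2`. This links the vector space results to `IsGeodesicOn`. -/
theorem geodesicForm_chartMetricCLM [IsContMDiffRiemannianBundle (𝓡 m) ∞ 𝔼
    (fun x : M ↦ TangentSpace (𝓡 m) x)] {x₀ : M} {y : 𝔼}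
    (hy : y ∈ (extChartAt (𝓡 m) x₀).target) (v u w : 𝔼) :
    geodesicForm (chartMetricCLM x₀) y v u w =
      chartMetric x₀ y u w + christoffelFirst x₀ y v v w := by
  rw [geodesicForm, christoffelFirst, fderiv_chartMetric hy, fderiv_chartMetric hy,
    chartMetricCLM_apply]
  ring

theorem differentiableAt_chartMetricCLM [IsContMDiffRiemannianBundle (𝓡 m) ∞ 𝔼
    (fun x : M ↦ TangentSpace (𝓡 m) x)] {x₀ : M} {y : 𝔼}
    (hy : y ∈ (extChartAt (𝓡 m) x₀).target) : DifferentiableAt ℝ (chartMetricCLM x₀) y :=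
  ((contDiffOn_chartMetricCLM x₀).contDiffAt ((isOpen_extChartAt_target x₀).mem_nhds
      hy)).differentiableAt (by simp)

theorem contDiffAt_transition {p x₀ : M} {y : 𝔼} (hy : y ∈ (extChartAt (𝓡 m) p).target)
    (hx : (extChartAt (𝓡 m) p).symm y ∈ (extChartAt (𝓡 m) x₀).source) :
    ContDiffAt ℝ ∞ (extChartAt (𝓡 m) x₀ ∘ (extChartAt (𝓡 m) p).symm) y :=
  (ContMDiffAt.comp y (contMDiffAt_extChartAt' (by simpa using hx))
    (contMDiffAt_extChartAt_symm_of_mem hy)).contDiffAt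

/-- All tangent spaces are the same type by definition, but their inner products depend on the base
point. This transports an inner product along an equality of base points without dependent
rewriting. -/
theorem inner_tangentSpace_congr {x x' : M} (h : x = x') {a a' b b' : 𝔼} (ha : a = a')
    (hb : b = b') : (inner ℝ (show TangentSpace (𝓡 m) x from a) (show TangentSpace (𝓡 m) x from b) : ℝ)
      = inner ℝ (show TangentSpace (𝓡 m) x' from a') (show TangentSpace (𝓡 m) x' from b') := by
  subst h ha hb
  rfl

/-- The transformation of the metric under the transition from the chart at `p` to the chart
at `x₀`. -/
theorem chartMetricCLM_transition {p x₀ : M} {y : 𝔼} (hy : y ∈ (extChartAt (𝓡 m) p).target)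
    (hx : (extChartAt (𝓡 m) p).symm y ∈ (extChartAt (𝓡 m) x₀).source) (a b : 𝔼) :
    chartMetricCLM p y a b =
      chartMetricCLM x₀ (extChartAt (𝓡 m) x₀ ((extChartAt (𝓡 m) p).symm y))
        (fderiv ℝ (extChartAt (𝓡 m) x₀ ∘ (extChartAt (𝓡 m) p).symm) y a)
        (fderiv ℝ (extChartAt (𝓡 m) x₀ ∘ (extChartAt (𝓡 m) p).symm) y b) := by
  set τ := extChartAt (𝓡 m) x₀ ∘ (extChartAt (𝓡 m) p).symm with hτ
  have hx' : τ y ∈ (extChartAt (𝓡 m) x₀).target := (extChartAt (𝓡 m) x₀).map_source hx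
  have hev : (extChartAt (𝓡 m) p).symm =ᶠ[𝓝 y] (extChartAt (𝓡 m) x₀).symm ∘ τ := by
    have : ∀ᶠ z in 𝓝 y, (extChartAt (𝓡 m) p).symm z ∈ (extChartAt (𝓡 m) x₀).source :=
      (contMDiffAt_extChartAt_symm_of_mem hy).continuousAt
        ((isOpen_extChartAt_source x₀).mem_nhds hx)
    filter_upwards [this] with z hz
    exact ((extChartAt (𝓡 m) x₀).left_inv hz).symm
  have hd (a : 𝔼) : (mfderiv 𝓘(ℝ, 𝔼) (𝓡 m) (extChartAt (𝓡 m) p).symm y a : 𝔼) =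
      mfderiv 𝓘(ℝ, 𝔼) (𝓡 m) (extChartAt (𝓡 m) x₀).symm (τ y) (fderiv ℝ τ y a) := by
    have h1 := mfderiv_comp (I'' := 𝓡 m) y (mdifferentiableAt_extChartAt_symm_of_mem hx')
      ((contDiffAt_transition hy hx).differentiableAt (by simp)).mdifferentiableAt
    rw [mfderiv_eq_fderiv] at h1
    exact congrArg (fun T : 𝔼 →L[ℝ] 𝔼 ↦ T a) (hev.mfderiv_eq.trans h1)
  exact inner_tangentSpace_congr hev.self_of_nhds (hd a) (hd b)

end ChartMetric

/-! ### Geodesics of the manifold: chart independence and uniqueness -/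

section GeodesicsInManifolds

set_option linter.unusedSectionVars false

variable {m : ℕ} {M : Type*} [TopologicalSpace M] [ChartedSpace (EuclideanSpace ℝ (Fin m)) M]
  [IsManifold (𝓡 m) ∞ M] [RiemannianBundle (fun x : M ↦ TangentSpace (𝓡 m) x)]
  [IsContMDiffRiemannianBundle (𝓡 m) ∞ (EuclideanSpace ℝ (Fin m))
    (fun x : M ↦ TangentSpace (𝓡 m) x)]

local notation "𝔼" => EuclideanSpace ℝ (Fin m)

/-- A kernel vector would have length zero by the transformation law of the metric; dimension turns
injectivity into surjectivity. Thus every test vector of the second chart comes from the first. -/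
theorem surjective_fderiv_transition {p x₀ : M} {y : 𝔼} (hy : y ∈ (extChartAt (𝓡 m) p).target)
    (hx : (extChartAt (𝓡 m) p).symm y ∈ (extChartAt (𝓡 m) x₀).source) :
    Function.Surjective (fderiv ℝ (extChartAt (𝓡 m) x₀ ∘ (extChartAt (𝓡 m) p).symm) y) := by
  refine (LinearMap.injective_iff_surjective
    (f := (fderiv ℝ (extChartAt (𝓡 m) x₀ ∘ (extChartAt (𝓡 m) p).symm) y : 𝔼 →ₗ[ℝ] 𝔼))).1 ?_
  refine (injective_iff_map_eq_zero _).2 fun a ha ↦ ?_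
  by_contra h0
  have h := chartMetricCLM_pos hy h0
  rw [ContinuousLinearMap.coe_coe] at ha
  rw [chartMetricCLM_transition hy hx, ha, map_zero] at h
  exact h.ne' rfl

/-- A solution of the geodesic equation in one chart is a geodesic. -/
theorem isGeodesicOn_extChartAt_symm {p : M} {c : ℝ → 𝔼} {J : Set ℝ} (hJ : IsOpen J)
    (hc : ContDiffOn ℝ ∞ c J) (hmem : ∀ t ∈ J, c t ∈ (extChartAt (𝓡 m) p).target)
    (hgeo : ∀ t ∈ J, ∀ w,
      geodesicForm (chartMetricCLM p) (c t) (deriv c t) (deriv (deriv c) t) w = 0) :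
    IsGeodesicOn (m := m) (fun t ↦ (extChartAt (𝓡 m) p).symm (c t)) J := by
  refine ⟨(contMDiffOn_extChartAt_symm p).comp hc.contMDiffOn hmem, fun t ht x₀ hx w' ↦ ?_⟩
  dsimp only
  set τ := extChartAt (𝓡 m) x₀ ∘ (extChartAt (𝓡 m) p).symm with hτ
  have hy := hmem t ht
  obtain ⟨w, rfl⟩ := surjective_fderiv_transition hy hx w'
  have hct := hc.contDiffAt (hJ.mem_nhds ht)
  have hsm : ∀ᶠ z in 𝓝 (c t), z ∈ (extChartAt (𝓡 m) p).target ∧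
      (extChartAt (𝓡 m) p).symm z ∈ (extChartAt (𝓡 m) x₀).source :=
    Filter.Eventually.and ((isOpen_extChartAt_target p).mem_nhds hy)
      ((contMDiffAt_extChartAt_symm_of_mem hy).continuousAt
        ((isOpen_extChartAt_source x₀).mem_nhds hx))
  have hd : deriv (fun s ↦ τ (c s)) =ᶠ[𝓝 t] fun s ↦ fderiv ℝ τ (c s) (deriv c s) := by
    filter_upwards [hct.continuousAt.eventually hsm, hJ.mem_nhds ht] with s hs hsJ
    exact (((contDiffAt_transition hs.1 hs.2).differentiableAt (by simp)).hasFDerivAt.comp_hasDerivAt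
      s ((hc.contDiffAt (hJ.mem_nhds hsJ)).differentiableAt (by simp)).hasDerivAt).deriv
  have hd0 : deriv (fun s ↦ τ (c s)) t = fderiv ℝ τ (c t) (deriv c t) := hd.self_of_nhds
  have hτt := contDiffAt_transition hy hx
  have hd2 : deriv (deriv (fun s ↦ τ (c s))) t =
      fderiv ℝ (fderiv ℝ τ) (c t) (deriv c t) (deriv c t)
        + fderiv ℝ τ (c t) (deriv (deriv c) t) := by
    rw [hd.deriv_eq]
    exact (HasFDerivAt.hasDerivAt_apply
      ((hτt.fderiv_right (m := ∞) (by simp)).differentiableAt (by simp)).hasFDerivAt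
      (hct.differentiableAt (by simp)).hasDerivAt
      (hct.deriv_infty.differentiableAt (by simp)).hasDerivAt).deriv
  have hx' : τ (c t) ∈ (extChartAt (𝓡 m) x₀).target := (extChartAt (𝓡 m) x₀).map_source hx
  have key := geodesicForm_pullback (chartMetricCLM_symm x₀) (differentiableAt_chartMetricCLM hx')
    (differentiableAt_chartMetricCLM hy) hτt
    (hsm.mono fun z hz ↦ chartMetricCLM_transition hz.1 hz.2) (deriv c t) (deriv (deriv c) t) w
  rw [hgeo t ht w, geodesicForm_chartMetricCLM hx', ← hd2, ← hd0] at key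
  exact key.symm

theorem RadialExpansion.IsGeodesicOn.eventually_chart {γ : ℝ → M} {J : Set ℝ}
    (h : IsGeodesicOn (m := m) γ J) (hJ : IsOpen J) {t : ℝ} (ht : t ∈ J) {x₀ : M}
    (hx : γ t ∈ (extChartAt (𝓡 m) x₀).source) :
    ∀ᶠ s in 𝓝 t, γ s ∈ (extChartAt (𝓡 m) x₀).source ∧
      ContDiffAt ℝ ∞ (fun s ↦ extChartAt (𝓡 m) x₀ (γ s)) s ∧
      ∀ w, geodesicForm (chartMetricCLM x₀) (extChartAt (𝓡 m) x₀ (γ s))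
        (deriv (fun s ↦ extChartAt (𝓡 m) x₀ (γ s)) s)
        (deriv (deriv (fun s ↦ extChartAt (𝓡 m) x₀ (γ s))) s) w = 0 := by
  filter_upwards [hJ.mem_nhds ht, (h.1.contMDiffAt (hJ.mem_nhds ht)).continuousAt
    ((isOpen_extChartAt_source x₀).mem_nhds hx)] with s hs hsx
  refine ⟨hsx, ?_, fun w ↦ ?_⟩
  · exact (ContMDiffAt.comp s (contMDiffAt_extChartAt' (by simpa using hsx))
      (h.1.contMDiffAt (hJ.mem_nhds hs))).contDiffAt
  · rw [geodesicForm_chartMetricCLM ((extChartAt (𝓡 m) x₀).map_source hsx)]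
    exact h.2 s hs x₀ hsx w

theorem RadialExpansion.IsGeodesicOn.eventuallyEq {γ₁ γ₂ : ℝ → M} {J : Set ℝ}
    (h₁ : IsGeodesicOn (m := m) γ₁ J) (h₂ : IsGeodesicOn (m := m) γ₂ J) (hJ : IsOpen J) {t : ℝ}
    (ht : t ∈ J) {x₀ : M} (hx : γ₁ t ∈ (extChartAt (𝓡 m) x₀).source) (heq : γ₁ t = γ₂ t)
    (hd : deriv (fun s ↦ extChartAt (𝓡 m) x₀ (γ₁ s)) t
      = deriv (fun s ↦ extChartAt (𝓡 m) x₀ (γ₂ s)) t) :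
    γ₁ =ᶠ[𝓝 t] γ₂ := by
  have e₁ := h₁.eventually_chart hJ ht hx
  have e₂ := h₂.eventually_chart hJ ht (heq ▸ hx)
  have := eventuallyEq_of_geodesic (isOpen_extChartAt_target x₀) (contDiffOn_chartMetricCLM x₀)
    (fun y hy a ha ↦ chartMetricCLM_pos hy ha) (e₁.mono fun s hs ↦ hs.2.1)
    (e₂.mono fun s hs ↦ hs.2.1) (by simp only [heq]) hd ((extChartAt (𝓡 m) x₀).map_source hx)
    (e₁.mono fun s hs ↦ hs.2.2) (e₂.mono fun s hs ↦ hs.2.2)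
  filter_upwards [this, e₁, e₂] with s hs hs₁ hs₂
  exact (extChartAt (𝓡 m) x₀).injOn hs₁.1 hs₂.1 hs

/-- The set of times near which the curves agree is open, and closed in `J`: at a limit time
positions agree because `M` is Hausdorff, chart velocities agree by continuity, and local uniqueness
applies. -/
theorem RadialExpansion.IsGeodesicOn.eqOn [T2Space M] {γ₁ γ₂ : ℝ → M} {J : Set ℝ}
    (h₁ : IsGeodesicOn (m := m) γ₁ J) (h₂ : IsGeodesicOn (m := m) γ₂ J) (hJ : IsOpen J)
    (hJ' : IsPreconnected J) {t₀ : ℝ} (ht₀ : t₀ ∈ J) (h0 : γ₁ =ᶠ[𝓝 t₀] γ₂) : EqOn γ₁ γ₂ J := by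
  have hsub : J ⊆ {t | γ₁ =ᶠ[𝓝 t] γ₂} := by
    refine hJ'.subset_of_closure_inter_subset isOpen_setOfPred_eventually_nhds ⟨t₀, ht₀, h0⟩ ?_
    rintro t ⟨htc, ht⟩
    have hfr : ∃ᶠ s in 𝓝 t, γ₁ =ᶠ[𝓝 s] γ₂ := mem_closure_iff_frequently.1 htc
    have heq : γ₁ t = γ₂ t := tendsto_nhds_unique_of_frequently_eq
      (h₁.1.contMDiffAt (hJ.mem_nhds ht)).continuousAt
      (h₂.1.contMDiffAt (hJ.mem_nhds ht)).continuousAt (hfr.mono fun s hs ↦ hs.self_of_nhds)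
    have hx := mem_extChartAt_source (I := 𝓡 m) (γ₁ t)
    have e₁ := h₁.eventually_chart hJ ht hx
    have e₂ := h₂.eventually_chart hJ ht (x₀ := γ₁ t) (heq ▸ hx)
    refine h₁.eventuallyEq h₂ hJ ht hx heq ?_
    refine tendsto_nhds_unique_of_frequently_eq
      e₁.self_of_nhds.2.1.deriv_infty.continuousAt
      e₂.self_of_nhds.2.1.deriv_infty.continuousAt (hfr.mono fun s hs ↦ ?_)
    refine Filter.EventuallyEq.deriv_eq ?_
    filter_upwards [hs] with z hz
    rw [hz]
  exact fun t ht ↦ (hsub ht).self_of_nhds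

theorem deriv_extChartAt_comp {γ : ℝ → M} {t : ℝ} {x₀ : M}
    (hγ : MDifferentiableAt 𝓘(ℝ, ℝ) (𝓡 m) γ t) (hx : γ t ∈ (extChartAt (𝓡 m) x₀).source) :
    deriv (fun s ↦ extChartAt (𝓡 m) x₀ (γ s)) t =
      mfderiv (𝓡 m) 𝓘(ℝ, 𝔼) (extChartAt (𝓡 m) x₀) (γ t) (mfderiv 𝓘(ℝ, ℝ) (𝓡 m) γ t (1 : ℝ)) := by
  have h := mfderiv_comp (I'' := 𝓘(ℝ, 𝔼)) t
    (mdifferentiableAt_extChartAt (I := 𝓡 m) (by simpa using hx)) hγ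
  rw [mfderiv_eq_fderiv] at h
  rw [← fderiv_apply_one_eq_deriv]
  exact congrArg (fun T : ℝ →L[ℝ] 𝔼 ↦ T 1) h

/-- Geodesics are determined by their initial velocity. -/
theorem RadialExpansion.IsGeodesicFrom.apply_one_eq [T2Space M] {p : M} {v : TangentSpace (𝓡 m) p}
    {γ₁ γ₂ : ℝ → M} (h₁ : IsGeodesicFrom (m := m) p v γ₁) (h₂ : IsGeodesicFrom (m := m) p v γ₂) :
    γ₁ 1 = γ₂ 1 := by
  obtain ⟨⟨a₁, b₁, ha₁, hb₁, hg₁⟩, hv₁⟩ := h₁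
  obtain ⟨⟨a₂, b₂, ha₂, hb₂, hg₂⟩, hv₂⟩ := h₂
  have hsub₁ : Ioo (max a₁ a₂) (min b₁ b₂) ⊆ Ioo a₁ b₁ :=
    Ioo_subset_Ioo (le_max_left _ _) (min_le_left _ _)
  have hsub₂ : Ioo (max a₁ a₂) (min b₁ b₂) ⊆ Ioo a₂ b₂ :=
    Ioo_subset_Ioo (le_max_right _ _) (min_le_right _ _)
  have k₁ : IsGeodesicOn (m := m) γ₁ (Ioo (max a₁ a₂) (min b₁ b₂)) :=
    ⟨hg₁.1.mono hsub₁, fun t ht ↦ hg₁.2 t (hsub₁ ht)⟩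
  have k₂ : IsGeodesicOn (m := m) γ₂ (Ioo (max a₁ a₂) (min b₁ b₂)) :=
    ⟨hg₂.1.mono hsub₂, fun t ht ↦ hg₂.2 t (hsub₂ ht)⟩
  have h0 : (0 : ℝ) ∈ Ioo (max a₁ a₂) (min b₁ b₂) :=
    ⟨max_lt ha₁ ha₂, lt_min (by linarith) (by linarith)⟩
  have h1 : (1 : ℝ) ∈ Ioo (max a₁ a₂) (min b₁ b₂) :=
    ⟨max_lt (by linarith) (by linarith), lt_min hb₁ hb₂⟩
  have hvv := hv₁.trans hv₂.symm
  have heq : γ₁ 0 = γ₂ 0 := congrArg TotalSpace.proj hvv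
  have hx := mem_extChartAt_source (I := 𝓡 m) (γ₁ 0)
  refine k₁.eqOn k₂ isOpen_Ioo isPreconnected_Ioo h0
    (k₁.eventuallyEq k₂ isOpen_Ioo h0 hx heq ?_) h1
  rw [deriv_extChartAt_comp ((k₁.1.contMDiffAt (Ioo_mem_nhds h0.1 h0.2)).mdifferentiableAt
    (by simp)) hx, deriv_extChartAt_comp ((k₂.1.contMDiffAt
    (Ioo_mem_nhds h0.1 h0.2)).mdifferentiableAt (by simp)) (heq ▸ hx)]
  exact congrArg (fun z : TangentBundle (𝓡 m) M ↦
    (mfderiv (𝓡 m) 𝓘(ℝ, 𝔼) (extChartAt (𝓡 m) (γ₁ 0)) z.proj z.snd : 𝔼)) hvv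

/-- Uniqueness makes the geodesic chosen in the definition of `expMap` irrelevant, so any explicit
geodesic computes it. -/
theorem expMap_eq [T2Space M] {p : M} {v : TangentSpace (𝓡 m) p} {γ : ℝ → M}
    (h : IsGeodesicFrom (m := m) p v γ) : expMap p v = γ 1 := by
  have hex : ∃ γ : ℝ → M, IsGeodesicFrom (m := m) p v γ := ⟨γ, h⟩
  rw [expMap, dif_pos hex]
  exact hex.choose_spec.apply_one_eq h

end GeodesicsInManifolds

/-! ### Local diffeomorphisms -/

theorem PartialDiffeomorph.exists_restr {𝕜 E E' H H' M N : Type*} [NontriviallyNormedField 𝕜]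
    [NormedAddCommGroup E] [NormedSpace 𝕜 E] [NormedAddCommGroup E'] [NormedSpace 𝕜 E']
    [TopologicalSpace H] [TopologicalSpace H'] {I : ModelWithCorners 𝕜 E H}
    {J : ModelWithCorners 𝕜 E' H'} [TopologicalSpace M] [ChartedSpace H M] [TopologicalSpace N]
    [ChartedSpace H' N] {k : WithTop ℕ∞} (e : PartialDiffeomorph I J M N k) {s : Set M}
    (hs : IsOpen s) (hsub : s ⊆ e.source) :
    ∃ e' : PartialDiffeomorph I J M N k, e'.source = s ∧ e'.target = e '' s ∧
      (∀ x, e' x = e x) ∧ ∀ y, e'.symm y = e.symm y := by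
  let f := e.toOpenPartialHomeomorph.restrOpen s hs
  have hfs : f.source = s := inter_eq_right.2 hsub
  refine ⟨
    { toPartialEquiv := f.toPartialEquiv
      open_source := f.open_source
      open_target := f.open_target
      contMDiffOn_toFun := e.contMDiffOn_toFun.mono inter_subset_left
      contMDiffOn_invFun := e.contMDiffOn_invFun.mono fun y hy ↦ hy.1 }, hfs, ?_,
    fun x ↦ rfl, fun y ↦ rfl⟩
  change f.target = f '' s
  rw [← hfs, f.image_source_eq_target]

theorem exists_partialDiffeomorph_of_hasFDerivAt_id {E : Type*} [NormedAddCommGroup E]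
    [NormedSpace ℝ E] [CompleteSpace E] {f : E → E} {r : ℝ} (hr : 0 < r)
    (hf : ContDiffOn ℝ ∞ f (ball 0 r)) (hd : HasFDerivAt f (.id ℝ E) 0) :
    ∃ ρ > 0, ρ ≤ r ∧ ∃ e : PartialDiffeomorph 𝓘(ℝ, E) 𝓘(ℝ, E) E E ∞,
      e.source = ball 0 ρ ∧ ∀ x, e x = f x := by
  have h0 : ContDiffAt ℝ ∞ f 0 := hf.contDiffAt (ball_mem_nhds 0 hr)
  let g := h0.toOpenPartialHomeomorph f (f' := .refl ℝ E) hd (by simp)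
  have hg : ∀ x, g x = f x := fun x ↦ rfl
  have hg0 : g.source ∈ 𝓝 (0 : E) :=
    g.open_source.mem_nhds (h0.mem_toOpenPartialHomeomorph_source (f' := .refl ℝ E) hd (by simp))
  -- Invertibility of the derivative on a whole ball is needed for the inverse to be smooth on the
  -- whole image, not only at `f 0`.
  have hinv : ∀ᶠ x in 𝓝 (0 : E), fderiv ℝ f x ∈ range ((↑) : (E ≃L[ℝ] E) → E →L[ℝ] E) := by
    refine (h0.fderiv_right (m := ∞) (by simp)).continuousAt (ContinuousLinearEquiv.isOpen.mem_nhds ?_)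
    exact ⟨.refl ℝ E, hd.fderiv.symm⟩
  obtain ⟨ρ, hρ, hb⟩ := Metric.eventually_nhds_iff_ball.1 (hinv.and (Filter.Eventually.and hg0 (ball_mem_nhds 0 hr)))
  have hbr : ball (0 : E) ρ ⊆ ball 0 r := fun x hx ↦ (hb x hx).2.2
  let f₁ := g.restrOpen (ball 0 (min ρ r)) isOpen_ball
  have hfs : f₁.source = ball 0 (min ρ r) := inter_eq_right.2 fun x hx ↦
    (hb x (ball_subset_ball (min_le_left _ _) hx)).2.1
  refine ⟨min ρ r, lt_min hρ hr, min_le_right _ _,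
    { toPartialEquiv := f₁.toPartialEquiv
      open_source := f₁.open_source
      open_target := f₁.open_target
      contMDiffOn_toFun := ?_
      contMDiffOn_invFun := ?_ }, hfs, fun x ↦ rfl⟩
  · refine ContDiffOn.contMDiffOn ?_
    rw [hfs]
    exact hf.mono (ball_subset_ball (min_le_right _ _))
  · intro y hy
    have hx : f₁.symm y ∈ ball (0 : E) (min ρ r) := hfs ▸ f₁.map_target hy
    obtain ⟨T, hT⟩ := (hb _ (ball_subset_ball (min_le_left _ _) hx)).1
    have hc : ContDiffAt ℝ ∞ f (f₁.symm y) :=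
      hf.contDiffAt (isOpen_ball.mem_nhds (ball_subset_ball (min_le_right _ _) hx))
    refine ContMDiffAt.contMDiffWithinAt (ContDiffAt.contMDiffAt ?_)
    exact f₁.contDiffAt_symm (f₀' := T) hy
      (by rw [hT]; exact (hc.differentiableAt (by simp)).hasFDerivAt) hc

/-! ### Normal coordinates -/

section NormalCoordinates

set_option linter.unusedSectionVars false

variable {m : ℕ} {M : Type*} [TopologicalSpace M] [ChartedSpace (EuclideanSpace ℝ (Fin m)) M]
  [IsManifold (𝓡 m) ∞ M] [RiemannianBundle (fun x : M ↦ TangentSpace (𝓡 m) x)]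
  [IsContMDiffRiemannianBundle (𝓡 m) ∞ (EuclideanSpace ℝ (Fin m))
    (fun x : M ↦ TangentSpace (𝓡 m) x)]

local notation "𝔼" => EuclideanSpace ℝ (Fin m)

theorem tangentBundle_mk_congr {x x' : M} (h : x = x') {a a' : 𝔼} (ha : a = a') :
    (⟨x, a⟩ : TangentBundle (𝓡 m) M) = ⟨x', a'⟩ := by
  subst h ha
  rfl

/-- The tangent space at `p` is the model space read in the preferred chart at `p`. Initial
velocities in that chart are therefore tangent vectors without any conversion. -/
theorem mfderiv_extChartAt_symm_self (p : M) (a : 𝔼) :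
    (mfderiv 𝓘(ℝ, 𝔼) (𝓡 m) (extChartAt (𝓡 m) p).symm (extChartAt (𝓡 m) p p) a : 𝔼) = a := by
  have h := mfderivWithin_range_extChartAt_symm (I := 𝓡 m) (x := p)
  rw [ModelWithCorners.range_eq_univ, mfderivWithin_univ] at h
  exact congrArg (fun T : 𝔼 →L[ℝ] 𝔼 ↦ T a) h

theorem mfderiv_extChartAt_symm_comp {V : Type*} [NormedAddCommGroup V] [NormedSpace ℝ V] {p : M}
    {f : V → 𝔼} {f' : V →L[ℝ] 𝔼} {x : V} (hf : HasFDerivAt f f' x)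
    (hx : f x ∈ (extChartAt (𝓡 m) p).target) (u : V) :
    (mfderiv 𝓘(ℝ, V) (𝓡 m) ((extChartAt (𝓡 m) p).symm ∘ f) x u : 𝔼) =
      mfderiv 𝓘(ℝ, 𝔼) (𝓡 m) (extChartAt (𝓡 m) p).symm (f x) (f' u) := by
  have h := (mdifferentiableAt_extChartAt_symm_of_mem hx).hasMFDerivAt.comp x hf.hasMFDerivAt
  exact congrArg (fun T : V →L[ℝ] 𝔼 ↦ T u) h.mfderiv

/-- The rays of a radial geodesic map in a chart are geodesics of the manifold. -/
theorem IsRadialGeodesicMap.isGeodesicFrom {p : M} {𝓔 : 𝔼 → 𝔼} {r : ℝ}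
    (h : IsRadialGeodesicMap (chartMetricCLM p) 𝓔 r) (h0 : 𝓔 0 = extChartAt (𝓡 m) p p)
    (hmem : ∀ x ∈ ball 0 r, 𝓔 x ∈ (extChartAt (𝓡 m) p).target) {x : 𝔼} (hx : x ∈ ball 0 r) :
    IsGeodesicFrom (m := m) p x (fun t : ℝ ↦ (extChartAt (𝓡 m) p).symm (𝓔 (t • x))) := by
  rw [mem_ball_zero_iff] at hx
  -- The ray stays in the ball for `|t| < r / ρ`, an interval reaching beyond `1`. Using `ρ` in
  -- place of `‖x‖` avoids division by zero when `x = 0`.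
  obtain ⟨ρ, hρ, hρr⟩ := exists_between hx
  have hρ0 : 0 < ρ := (norm_nonneg x).trans_lt hρ
  have hs1 : 1 < r / ρ := (one_lt_div hρ0).2 hρr
  have hJ : ∀ t ∈ Ioo (-(r / ρ)) (r / ρ), t • x ∈ ball (0 : 𝔼) r := by
    intro t ht
    rw [mem_ball_zero_iff, norm_smul, Real.norm_eq_abs]
    have h1 : |t| * ‖x‖ ≤ |t| * ρ := by gcongr
    have h2 : |t| * ρ < r / ρ * ρ := by
      gcongr
      exact abs_lt.2 ht
    rw [div_mul_cancel₀ _ hρ0.ne'] at h2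
    exact h1.trans_lt h2
  have hd1 : ∀ t ∈ Ioo (-(r / ρ)) (r / ρ),
      HasDerivAt (fun t : ℝ ↦ 𝓔 (t • x)) (fderiv ℝ 𝓔 (t • x) x) t :=
    fun t ht ↦ (h.hasFDerivAt (hJ t ht)).hasDerivAt_ray
  have hd2 : ∀ t ∈ Ioo (-(r / ρ)) (r / ρ), deriv (deriv fun t : ℝ ↦ 𝓔 (t • x)) t =
      fderiv ℝ (fderiv ℝ 𝓔) (t • x) x x := by
    intro t ht
    have : deriv (fun t : ℝ ↦ 𝓔 (t • x)) =ᶠ[𝓝 t] fun t ↦ fderiv ℝ 𝓔 (t • x) x := by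
      filter_upwards [Ioo_mem_nhds ht.1 ht.2] with s hs using (hd1 s hs).deriv
    rw [this.deriv_eq]
    exact ((h.hasFDerivAt_fderiv (hJ t ht)).hasDerivAt_ray_apply x).deriv
  refine ⟨⟨-(r / ρ), r / ρ, by linarith, hs1, ?_⟩, ?_⟩
  · refine isGeodesicOn_extChartAt_symm isOpen_Ioo ?_ (fun t ht ↦ hmem _ (hJ t ht)) ?_
    · exact h.smooth.comp (contDiff_id.smul contDiff_const).contDiffOn hJ
    · intro t ht w
      rw [hd2 t ht, (hd1 t ht).deriv]
      exact h.geodesic x t (hJ t ht) w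
  · have hp : (extChartAt (𝓡 m) p).symm (𝓔 ((0 : ℝ) • x)) = p := by
      rw [zero_smul, h0, extChartAt_to_inv]
    have h1 := hd1 0 ⟨by linarith, by linarith⟩
    have hy : 𝓔 ((0 : ℝ) • x) ∈ (extChartAt (𝓡 m) p).target := by
      rw [zero_smul, h0]
      exact mem_extChartAt_target p
    refine tangentBundle_mk_congr hp
      ((mfderiv_extChartAt_symm_comp (f := fun t : ℝ ↦ 𝓔 (t • x)) h1.hasFDerivAt hy (1 : ℝ)).trans ?_)
    rw [zero_smul, h.hasFDerivAt_zero.fderiv, h0]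
    refine (mfderiv_extChartAt_symm_self p _).trans ?_
    simp
    rfl

/-- Normal coordinates at `p`, in terms of a Euclidean space `V` isometric to the tangent space. -/
theorem exists_normalCoordinates {V : Type*} [NormedAddCommGroup V] [InnerProductSpace ℝ V]
    (p : M) (L : V ≃L[ℝ] 𝔼)
    (hL : ∀ u w, inner ℝ u w = chartMetricCLM p (extChartAt (𝓡 m) p p) (L u) (L w)) :
    ∃ δ > 0, ∃ e : PartialDiffeomorph 𝓘(ℝ, V) (𝓡 m) V M ∞, ∃ H : V → V →L[ℝ] V →L[ℝ] ℝ,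
      ball 0 δ ⊆ e.source ∧ e 0 = p ∧ ContDiffOn ℝ ∞ H (ball 0 δ) ∧ (∀ u w, H 0 u w = inner ℝ u w) ∧
      (∀ x u w, H x u w = H x w u) ∧ (∀ x ∈ ball 0 δ, ∀ u, H x x u = inner ℝ x u) ∧
      ∀ x ∈ ball 0 δ, (∃ γ : ℝ → M, IsGeodesicFrom (m := m) p (L x) γ ∧ γ 1 = e x) ∧
        ∀ u w, inner ℝ (mfderiv 𝓘(ℝ, V) (𝓡 m) e x u) (mfderiv 𝓘(ℝ, V) (𝓡 m) e x w) = H x u w := by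
  have : FiniteDimensional ℝ V := L.symm.toLinearEquiv.finiteDimensional
  obtain ⟨r, hr, 𝓔, h0, h, hmem⟩ := exists_isRadialGeodesicMap (isOpen_extChartAt_target (I := 𝓡 m) p)
    (contDiffOn_chartMetricCLM (m := m) p) (fun y hy a ha ↦ chartMetricCLM_pos hy ha)
    (chartMetricCLM_symm (m := m) p) (mem_extChartAt_target p)
  obtain ⟨ρ, hρ, hρr, e₁, he₁, he₁'⟩ :=
    exists_partialDiffeomorph_of_hasFDerivAt_id hr h.smooth h.hasFDerivAt_zero
  let ψ : PartialDiffeomorph 𝓘(ℝ, 𝔼) (𝓡 m) 𝔼 M ∞ :=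
    { toPartialEquiv := (extChartAt (𝓡 m) p).symm
      open_source := isOpen_extChartAt_target p
      open_target := isOpen_extChartAt_source p
      contMDiffOn_toFun := contMDiffOn_extChartAt_symm p
      contMDiffOn_invFun := by
        have := contMDiffOn_extChartAt (I := 𝓡 m) (n := ∞) (x := p)
        rwa [← extChartAt_source (𝓡 m)] at this }
  let e := (L.toDiffeomorph.toPartialDiffeomorph (n := ∞)).trans (e₁.trans ψ)
  have he : ∀ x, e x = (extChartAt (𝓡 m) p).symm (𝓔 (L x)) := fun x ↦
    congrArg (extChartAt (𝓡 m) p).symm (he₁' (L x))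
  obtain ⟨δ, hδ, hb⟩ : ∃ δ > 0, ∀ x ∈ ball (0 : V) δ, L x ∈ ball (0 : 𝔼) ρ := by
    refine Metric.eventually_nhds_iff_ball.1 (L.continuous.continuousAt ?_)
    rw [map_zero]
    exact ball_mem_nhds 0 hρ
  have hbr : ∀ x ∈ ball (0 : V) δ, L x ∈ ball (0 : 𝔼) r := fun x hx ↦
    ball_subset_ball hρr (hb x hx)
  -- `H` is the pullback of the chart metric by `𝓔 ∘ L`; the Gauss lemma and the value at `0` are
  -- read off from those of `𝓔`.
  obtain ⟨H, hH⟩ : ∃ H : V → V →L[ℝ] V →L[ℝ] ℝ, ∀ x u w, H x u w =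
      chartMetricCLM p (𝓔 (L x)) (fderiv ℝ 𝓔 (L x) (L u)) (fderiv ℝ 𝓔 (L x) (L w)) :=
    ⟨fun x ↦ (chartMetricCLM p (𝓔 (L x))).bilinearComp
    (fderiv ℝ 𝓔 (L x) ∘L (L : V →L[ℝ] 𝔼)) (fderiv ℝ 𝓔 (L x) ∘L (L : V →L[ℝ] 𝔼)),
      fun x u w ↦ rfl⟩
  refine ⟨δ, hδ, e, H, ?_, ?_, ?_, ?_, ?_, ?_, fun x hx ↦ ⟨⟨_, h.isGeodesicFrom h0 hmem (hbr x hx), ?_⟩, ?_⟩⟩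
  · intro x hx
    refine ⟨mem_univ _, ?_, ?_⟩
    · change L x ∈ e₁.source
      rw [he₁]
      exact hb x hx
    · change e₁ (L x) ∈ (extChartAt (𝓡 m) p).target
      rw [he₁']
      exact hmem _ (hbr x hx)
  · rw [he, map_zero, h0, extChartAt_to_inv]
  · have hLs : ContDiffOn ℝ ∞ L (ball 0 δ) := L.contDiff.contDiffOn
    have hG : ContDiffOn ℝ ∞ (fun x ↦ chartMetricCLM p (𝓔 (L x))) (ball 0 δ) :=
      (contDiffOn_chartMetricCLM p).comp (h.smooth.comp hLs hbr) fun x hx ↦ hmem _ (hbr x hx)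
    have hD : ContDiffOn ℝ ∞ (fun x ↦ fderiv ℝ 𝓔 (L x)) (ball 0 δ) :=
      (h.smooth.fderiv_of_isOpen isOpen_ball (m := ∞) (by simp)).comp hLs hbr
    refine contDiffOn_clm_apply.2 fun u ↦ contDiffOn_clm_apply.2 fun w ↦ ?_
    simp only [hH]
    exact (hG.clm_apply (hD.clm_apply contDiffOn_const)).clm_apply (hD.clm_apply contDiffOn_const)
  · intro u w
    rw [hH, map_zero, h0, h.hasFDerivAt_zero.fderiv, hL]
    rfl
  · exact fun x u w ↦ by rw [hH, hH, chartMetricCLM_symm]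
  · intro x hx u
    rw [hH, h.gauss (hbr x hx), h0, hL]
  · rw [one_smul, he]
  · intro u w
    have hev : (e : V → M) = (extChartAt (𝓡 m) p).symm ∘ (𝓔 ∘ L) := funext he
    have hd : HasFDerivAt (𝓔 ∘ L) (fderiv ℝ 𝓔 (L x) ∘L (L : V →L[ℝ] 𝔼)) x :=
      (h.hasFDerivAt (hbr x hx)).comp x L.hasFDerivAt
    have hy := hmem _ (hbr x hx)
    rw [hev]
    exact (inner_tangentSpace_congr rfl (mfderiv_extChartAt_symm_comp hd hy u)
      (mfderiv_extChartAt_symm_comp hd hy w)).trans (hH x u w).symm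

end NormalCoordinates

/-! ### The family of metrics on the unit sphere -/

section PolarMetric

variable {V : Type*} [NormedAddCommGroup V] [InnerProductSpace ℝ V] {n : ℕ}
  [Fact (Module.finrank ℝ V = n + 1)]

/-- The family of metrics `t² H_{t x}` on the unit sphere, for a metric `H` on a ball of `V`. -/
theorem exists_polar_productMetric {H : V → V →L[ℝ] V →L[ℝ] ℝ} {ε : ℝ}
    (hH : ContDiffOn ℝ ∞ H (ball 0 ε)) (hsymm : ∀ x u w, H x u w = H x w u)
    (hpos : ∀ x ∈ ball (0 : V) ε, ∀ u ≠ 0, 0 < H x u u)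
    (hexp : ∀ t ∈ Ioo 0 ε, ∀ v : V, ‖v‖ = 1 → ∀ u ≠ 0,
      0 < deriv (fun s : ℝ ↦ s ^ 2 * H (s • v) u u) t) :
    ∃ G : ProductMetric (k := n) (Ioo 0 ε) (sphere (0 : V) 1),
      (∀ t ∈ Ioo 0 ε, G.β t = 1) ∧
      (∀ (t : ℝ) (x : sphere (0 : V) 1) (u w : TangentSpace (𝓡 n) x), G.g t x u w =
        t ^ 2 * H (t • (x : V)) (mvfderiv (𝓡 n) ((↑) : sphere (0 : V) 1 → V) x u)
          (mvfderiv (𝓡 n) ((↑) : sphere (0 : V) 1 → V) x w)) ∧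
      G.IsExpanding := by
  have hmem : ∀ t ∈ Ioo 0 ε, ∀ x : sphere (0 : V) 1, t • (x : V) ∈ ball (0 : V) ε := by
    intro t ht x
    rw [mem_ball_zero_iff, norm_smul, norm_eq_of_mem_sphere x, mul_one, Real.norm_of_nonneg ht.1.le]
    exact ht.2
  have hinj : ∀ (x : sphere (0 : V) 1) (u : TangentSpace (𝓡 n) x), u ≠ 0 →
      mvfderiv (𝓡 n) ((↑) : sphere (0 : V) 1 → V) x u ≠ 0 := fun x u hu h ↦
    hu (injective_mvfderiv_subtypeVal_sphere x (h.trans (map_zero _).symm))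
  let ι : sphere (0 : V) 1 → EuclideanSpace ℝ (Fin n) →L[ℝ] V :=
    fun x ↦ mvfderiv (𝓡 n) ((↑) : sphere (0 : V) 1 → V) x
  let g : ℝ → ∀ x : sphere (0 : V) 1,
      TangentSpace (𝓡 n) x →L[ℝ] TangentSpace (𝓡 n) x →L[ℝ] ℝ :=
    fun t x ↦ (show EuclideanSpace ℝ (Fin n) →L[ℝ] EuclideanSpace ℝ (Fin n) →L[ℝ] ℝ from
      (t ^ 2 • H (t • (x : V))).bilinearComp (ι x) (ι x))
  have hg : ∀ (t : ℝ) (x : sphere (0 : V) 1) (u w : TangentSpace (𝓡 n) x), g t x u w =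
        t ^ 2 * H (t • (x : V)) (ι x u) (ι x w) := fun t x u w ↦ rfl
  refine ⟨
    { isOpen := isOpen_Ioo
      ordConnected := ordConnected_Ioo
      β := fun _ ↦ 1
      β_pos := fun _ _ ↦ one_pos
      β_smooth := contDiffOn_const
      g := g
      g_symm := fun t _ x u w ↦ by rw [hg, hg, hsymm]
      g_pos := fun t ht x u hu ↦ by
        rw [hg]
        exact mul_pos (pow_pos ht.1 2) (hpos _ (hmem t ht x) _ (hinj x u hu))
      g_smooth := ?_ }, fun _ _ ↦ rfl, hg, ?_⟩
  · rintro ⟨t, x⟩ ⟨ht, -⟩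
    refine ContMDiffAt.contMDiffWithinAt ?_
    refine contMDiffAt_pullback_bilin (f := ((↑) : sphere (0 : V) 1 → V)) (pr := Prod.snd)
      (B := fun q ↦ q.1 ^ 2 • H (q.1 • (q.2 : V))) (φ := fun q ↦ g q.1 q.2)
      contMDiff_coe_sphere contMDiffAt_snd ?_ (Eventually.of_forall fun q u w ↦ rfl)
    refine ContMDiffAt.smul (contMDiffAt_fst.pow 2) ?_
    exact ContMDiffAt.comp (t, x) (hH.contDiffAt (isOpen_ball.mem_nhds (hmem t ht x))).contMDiffAt
      contMDiff_smul_coe_sphere.contMDiffAt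
  · intro t ht
    refine ⟨by simp, fun x u hu ↦ ?_⟩
    exact hexp t ht x (norm_eq_of_mem_sphere x) _ (hinj x u hu)

end PolarMetric

/-! ### Polar coordinates as an isometry -/

section PolarIsometry

variable {V : Type*} [NormedAddCommGroup V] [InnerProductSpace ℝ V] {n : ℕ}
  [Fact (Module.finrank ℝ V = n + 1)]
  {m : ℕ} {M : Type*} [TopologicalSpace M] [ChartedSpace (EuclideanSpace ℝ (Fin m)) M]

theorem mfderiv_comp_smul_coe_sphere {f : V → M} {t : ℝ} {x : sphere (0 : V) 1}
    (hf : MDifferentiableAt 𝓘(ℝ, V) (𝓡 m) f (t • (x : V))) (a : ℝ) (u : TangentSpace (𝓡 n) x) :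
    mfderiv (𝓘(ℝ, ℝ).prod (𝓡 n)) (𝓡 m) (fun q : ℝ × sphere (0 : V) 1 ↦ f (q.1 • (q.2 : V)))
      (t, x) (a, u) = mfderiv 𝓘(ℝ, V) (𝓡 m) f (t • (x : V))
        (a • (x : V) + t • mvfderiv (𝓡 n) ((↑) : sphere (0 : V) 1 → V) x u) := by
  have hs : MDifferentiableAt (𝓘(ℝ, ℝ).prod (𝓡 n)) 𝓘(ℝ, V)
      (fun q : ℝ × sphere (0 : V) 1 ↦ q.1 • (q.2 : V)) (t, x) :=
    contMDiff_smul_coe_sphere.mdifferentiableAt (by simp)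
  have h := mfderiv_comp (I'' := 𝓡 m) (t, x) (g := f) hf hs
  rw [← mvfderiv_smul_coe_sphere]
  exact congrArg (fun T ↦ T (a, u)) h

theorem mfderiv_comp_smul {f : V → M} {t : ℝ} {v : V}
    (hf : MDifferentiableAt 𝓘(ℝ, V) (𝓡 m) f (t • v)) :
    mfderiv 𝓘(ℝ, ℝ) (𝓡 m) (fun s : ℝ ↦ f (s • v)) t (1 : ℝ) =
      mfderiv 𝓘(ℝ, V) (𝓡 m) f (t • v) v := by
  have hs : HasDerivAt (fun s : ℝ ↦ s • v) v t := by
    simpa using (hasDerivAt_id t).smul_const v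
  have h := mfderiv_comp (I'' := 𝓡 m) t (g := f) hf hs.differentiableAt.mdifferentiableAt
  refine (congrArg (fun T ↦ T (1 : ℝ)) h).trans ?_
  rw [mfderiv_eq_fderiv]
  change mfderiv 𝓘(ℝ, V) (𝓡 m) f (t • v) (fderiv ℝ (fun s : ℝ ↦ s • v) t 1) = _
  rw [fderiv_apply_one_eq_deriv, hs.deriv]

variable [IsManifold (𝓡 m) ∞ M] [RiemannianBundle (fun x : M ↦ TangentSpace (𝓡 m) x)]

/-- If, in the coordinates `e`, the radial directions are orthonormal to the spheres around `0`,
then polar coordinates turn the metric into `dr² + h_r`, and for small radii the family `h_r` is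
increasing. -/
theorem exists_polar_isometry {e : PartialDiffeomorph 𝓘(ℝ, V) (𝓡 m) V M ∞}
    {H : V → V →L[ℝ] V →L[ℝ] ℝ} {δ : ℝ} (hδ : 0 < δ) (hsub : ball 0 δ ⊆ e.source)
    (hH : ContDiffOn ℝ ∞ H (ball 0 δ)) (h0 : ∀ u w, H 0 u w = inner ℝ u w)
    (hsymm : ∀ x u w, H x u w = H x w u) (hgauss : ∀ x ∈ ball 0 δ, ∀ u, H x x u = inner ℝ x u)
    (hmet : ∀ x ∈ ball 0 δ, ∀ u w,
      inner ℝ (mfderiv 𝓘(ℝ, V) (𝓡 m) e x u) (mfderiv 𝓘(ℝ, V) (𝓡 m) e x w) = H x u w)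
    {f : V → M} (hf : EqOn f e (ball 0 δ)) :
    ∃ δ' > 0, δ' ≤ δ ∧ ∀ ε, 0 < ε → ε ≤ δ' →
      (∃ e' : PartialDiffeomorph 𝓘(ℝ, V) (𝓡 m) V M ∞, e'.source = ball 0 ε ∧
        e'.target = f '' ball 0 ε ∧ EqOn e' f e'.source) ∧
      ∃ Z : ∀ q : M, TangentSpace (𝓡 m) q,
        (∀ r ∈ Ioo 0 ε, ∀ v : V, ‖v‖ = 1 →
          Z (f (r • v)) = mfderiv 𝓘(ℝ, ℝ) (𝓡 m) (fun s : ℝ ↦ f (s • v)) r (1 : ℝ)) ∧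
        ∃ G : ProductMetric (k := n) (Ioo 0 ε) (sphere (0 : V) 1),
          (∀ t ∈ Ioo 0 ε, G.β t = 1) ∧
          G.IsIsometryOnto (fun q ↦ f (q.1 • (q.2 : V))) (f '' ball 0 ε \ {e 0}) Z ∧
          G.IsExpanding := by
  obtain ⟨δ', hδ', hle, hpos, hexp⟩ := exists_radius_expanding hδ hH
    (fun u ↦ by rw [h0, real_inner_self_eq_norm_sq])
  refine ⟨δ', hδ', hle, fun ε hε hεδ ↦ ?_⟩
  have hball : ball (0 : V) ε ⊆ ball 0 δ := ball_subset_ball (hεδ.trans hle)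
  have hball' : ball (0 : V) ε ⊆ ball 0 δ' := ball_subset_ball hεδ
  have hev : ∀ x ∈ ball (0 : V) ε, f =ᶠ[𝓝 x] e := fun x hx ↦
    hf.eventuallyEq_of_mem (isOpen_ball.mem_nhds (hball hx))
  have hfd : ∀ x ∈ ball (0 : V) ε, MDifferentiableAt 𝓘(ℝ, V) (𝓡 m) f x := fun x hx ↦
    (e.mdifferentiableAt (by simp) (hsub (hball hx))).congr_of_eventuallyEq (hev x hx)
  have hfe : ∀ x ∈ ball (0 : V) ε, ∀ u,
      (mfderiv 𝓘(ℝ, V) (𝓡 m) f x u : EuclideanSpace ℝ (Fin m)) = mfderiv 𝓘(ℝ, V) (𝓡 m) e x u :=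
    fun x hx u ↦ congrArg (fun T : V →L[ℝ] EuclideanSpace ℝ (Fin m) ↦ T u) (hev x hx).mfderiv_eq
  have himg : e '' ball 0 ε = f '' ball 0 ε := (image_congr fun x hx ↦ hf (hball hx)).symm
  have hmem : ∀ t ∈ Ioo 0 ε, ∀ v : V, ‖v‖ = 1 → t • v ∈ ball (0 : V) ε := by
    intro t ht v hv
    rw [mem_ball_zero_iff, norm_smul, hv, mul_one, Real.norm_of_nonneg ht.1.le]
    exact ht.2
  obtain ⟨e', hes, het, hee, hei⟩ := e.exists_restr isOpen_ball (hball.trans hsub)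
  rw [himg] at het
  refine ⟨⟨e', hes, het, fun x hx ↦ (hee x).trans (hf (hball (hes ▸ hx))).symm⟩, ?_⟩
  -- The image under `Df` of the unit radial vector at `e.symm q`. Its values off the punctured ball
  -- play no role.
  let Z : ∀ q : M, TangentSpace (𝓡 m) q := fun q ↦
    (show EuclideanSpace ℝ (Fin m) from
      mfderiv 𝓘(ℝ, V) (𝓡 m) f (e.symm q) (‖e.symm q‖⁻¹ • e.symm q))
  have hZ : ∀ t ∈ Ioo 0 ε, ∀ v : V, ‖v‖ = 1 →
      Z (f (t • v)) = mfderiv 𝓘(ℝ, V) (𝓡 m) f (t • v) v := by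
    intro t ht v hv
    have hx := hmem t ht v hv
    have h1 : e.symm (f (t • v)) = t • v := by
      rw [hf (hball hx)]
      exact e.left_inv (hsub (hball hx))
    have h2 : ‖t • v‖⁻¹ • t • v = v := by
      rw [norm_smul, hv, mul_one, Real.norm_of_nonneg ht.1.le, smul_smul,
        inv_mul_cancel₀ ht.1.ne', one_smul]
    change (mfderiv 𝓘(ℝ, V) (𝓡 m) f (e.symm (f (t • v)))
      (‖e.symm (f (t • v))‖⁻¹ • e.symm (f (t • v))) : EuclideanSpace ℝ (Fin m)) = _
    rw [h1, h2]
  refine ⟨Z, fun t ht v hv ↦ (hZ t ht v hv).trans (mfderiv_comp_smul (hfd _ (hmem t ht v hv))).symm,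
    ?_⟩
  obtain ⟨G, hβ, hg, hG⟩ := exists_polar_productMetric (n := n) (hH.mono hball) hsymm
    (fun x hx ↦ hpos x (hball' hx)) (fun t ht ↦ hexp t ⟨ht.1, ht.2.trans_le hεδ⟩)
  refine ⟨G, hβ, ⟨?_, ?_, ?_⟩, hG⟩
  · obtain ⟨P, hPs, hPt, hP⟩ := exists_polar_partialDiffeomorph (V := V) (n := n) ε
    have h0s : (0 : V) ∈ e'.source := by rw [hes]; exact mem_ball_self hε
    have he0 : e' 0 = e 0 := hee 0
    refine ⟨P.trans e', ?_, ?_, ?_⟩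
    · change P.source ∩ P ⁻¹' e'.source = _
      rw [hPs, inter_eq_left]
      intro q hq
      have : P q ∈ P.target := P.map_source (hPs ▸ hq)
      rw [hPt] at this
      rw [mem_preimage, hes]
      exact this.1
    · change e'.target ∩ e'.symm ⁻¹' P.target = _
      rw [hPt, ← het]
      ext q
      refine and_congr_right fun hq ↦ ?_
      have hq' : e'.symm q ∈ ball (0 : V) ε := hes ▸ e'.map_target hq
      have hr : e' (e'.symm q) = q := e'.right_inv hq
      rw [mem_preimage, Set.mem_sdiff, mem_singleton_iff, mem_singleton_iff, ← he0]
      refine ⟨fun h hq0 ↦ h.2 ?_, fun h ↦ ⟨hq', fun h1 ↦ h ?_⟩⟩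
      · rw [hq0]
        exact e'.left_inv h0s
      · rw [← hr, h1]
    · rintro q ⟨hq, hq'⟩
      change e' (P q) = f (q.1 • (q.2 : V))
      have hb : P q ∈ ball (0 : V) ε := hes ▸ hq'
      rw [hP] at hb ⊢
      rw [hee, hf (hball hb)]
  · intro t ht x a b u w
    have hx1 : ‖(x : V)‖ = 1 := norm_eq_of_mem_sphere x
    have hx := hmem t ht x hx1
    set y : V := t • (x : V) with hy
    -- The Gauss lemma at `y = t x`, divided by `t`.
    have hgx : ∀ z, H y x z = inner ℝ (x : V) z := by
      intro z
      have := hgauss y (hball hx) z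
      rw [hy, map_smul, smul_apply, inner_smul_left, smul_eq_mul] at this
      exact mul_left_cancel₀ ht.1.ne' this
    have hxx : inner ℝ (x : V) (x : V) = 1 := by
      rw [real_inner_self_eq_norm_sq, hx1, one_pow]
    rw [hβ t ht, hg]
    have key : ∀ a' b' : V, inner ℝ (mfderiv 𝓘(ℝ, V) (𝓡 m) f y a') (mfderiv 𝓘(ℝ, V) (𝓡 m) f y b')
        = H y a' b' := fun a' b' ↦
      (inner_tangentSpace_congr (hf (hball hx)) (hfe y hx a') (hfe y hx b')).trans
        (hmet y (hball hx) a' b')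
    refine (inner_tangentSpace_congr rfl (mfderiv_comp_smul_coe_sphere (hfd _ hx) a u)
      (mfderiv_comp_smul_coe_sphere (hfd _ hx) b w)).trans ((key _ _).trans ?_)
    -- The radial part contributes `a b`, the mixed terms vanish since sphere directions are
    -- orthogonal to `x`, and the tangential part is `t² H`.
    simp only [map_add, map_smul, add_apply, smul_apply, smul_eq_mul, hsymm y _ (x : V), hgx, hxx,
      inner_mvfderiv_coe_sphere]
    ring
  · intro t ht x
    have hx1 : ‖(x : V)‖ = 1 := norm_eq_of_mem_sphere x
    refine (mfderiv_comp_smul_coe_sphere (hfd _ (hmem t ht x hx1)) 1 0).trans ?_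
    refine Eq.trans ?_ (hZ t ht x hx1).symm
    simp

end PolarIsometry

end

/-! ### The theorem on small geodesic balls -/

theorem mainTheorem12 {n : ℕ} {M : Type*} [TopologicalSpace M] [T2Space M]
    [ChartedSpace (EuclideanSpace ℝ (Fin (n + 1))) M] [IsManifold (𝓡 (n + 1)) ∞ M]
    [RiemannianBundle (fun x : M ↦ TangentSpace (𝓡 (n + 1)) x)]
    [IsContMDiffRiemannianBundle (𝓡 (n + 1)) ∞ (EuclideanSpace ℝ (Fin (n + 1)))
      (fun x : M ↦ TangentSpace (𝓡 (n + 1)) x)]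
    (p : M) :
    ∃ δ : ℝ, 0 < δ ∧ ∀ ε : ℝ, 0 < ε → ε ≤ δ →
      RadialExpansion.IsNormalBall (m := n + 1) p ε ∧
      ∃ Z : ∀ q : M, TangentSpace (𝓡 (n + 1)) q,
        RadialExpansion.IsRadialField p ε Z ∧
        ∃ G : RadialExpansion.ProductMetric (k := n) (Ioo 0 ε)
            (Metric.sphere (0 : TangentSpace (𝓡 (n + 1)) p) 1),
          (∀ t ∈ Ioo 0 ε, G.β t = 1) ∧
          G.IsIsometryOnto (RadialExpansion.polarMap (m := n + 1) p)
            (RadialExpansion.geodesicBall (m := n + 1) p ε \ {p}) Z ∧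
          G.IsExpanding := by
  -- `L` is the identity map; it only exchanges the norm given by the metric at `p` for the
  -- Euclidean norm of the model space.
  let L : TangentSpace (𝓡 (n + 1)) p ≃L[ℝ] EuclideanSpace ℝ (Fin (n + 1)) :=
    (ContinuousLinearEquiv.refl ℝ (EuclideanSpace ℝ (Fin (n + 1))) :)
  have hL : ∀ u w : TangentSpace (𝓡 (n + 1)) p, inner ℝ u w =
      chartMetricCLM p (extChartAt (𝓡 (n + 1)) p p) (L u) (L w) := fun u w ↦
    inner_tangentSpace_congr (extChartAt_to_inv p).symm (mfderiv_extChartAt_symm_self p u).symm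
      (mfderiv_extChartAt_symm_self p w).symm
  obtain ⟨δ, hδ, e, H, hsub, he0, hH, h0, hsymm, hgauss, hgeo⟩ := exists_normalCoordinates p L hL
  have hexp : EqOn (RadialExpansion.expMap (m := n + 1) p) e (Metric.ball 0 δ) := by
    intro v hv
    obtain ⟨γ, hγ, hγ1⟩ := (hgeo v hv).1
    exact (expMap_eq hγ).trans hγ1
  obtain ⟨δ', hδ', hle, h⟩ := exists_polar_isometry (n := n) hδ hsub hH h0 hsymm hgauss
    (fun x hx ↦ (hgeo x hx).2) hexp
  refine ⟨δ', hδ', fun ε hε hεδ ↦ ?_⟩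
  obtain ⟨h1, Z, hZ, G, hβ, hG, hG'⟩ := h ε hε hεδ
  rw [he0] at hG
  refine ⟨⟨fun v hv ↦ ?_, h1⟩, Z, hZ, G, hβ, hG, hG'⟩
  obtain ⟨γ, hγ, -⟩ := (hgeo v (Metric.ball_subset_ball (hεδ.trans hle) hv)).1
  exact ⟨γ, hγ⟩
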